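/- Let $M$ be a finite-dimensional smooth manifold (Hausdorff, second countable, without boundary) and let $\pi\colon Y\to M$ be a surjective submersion from a smooth (possibly infinite-dimensional, normed-space-modelled) manifold $Y$ without boundary. Write $Y^{[p]}$ for the $p$-fold fibre product of $Y$ over $M$. For a (smooth principal) $U(1)$-bundle $R\to Y$ let $\delta(R)\to Y^{[2]}$ be the $U(1)$-bundle with fibres $\delta(R)_{(y_1,y_2)}=R_{y_1}\otimes R_{y_2}^*$. A bundle gerbe $(P,Y)$ over $M$ is a $U(1)$-bundle $P\to Y^{[2]}$ with a smooth isomorphism $m\colon P_{(y_1,y_2)}\otimes P_{(y_2,y_3)}\to P_{(y_1,y_3)}$ of $U(1)$-bundles over $Y^{[3]}$ which is associative over $Y^{[4]}$. For example, $(\delta(R),Y)$ is a bundle gerbe with the multiplication given by the contraction $R_{y_1}\otimes R_{y_2}^*\otimes R_{y_2}\otimes R_{y_3}^*\to R_{y_1}\otimes R_{y_3}^*$. A trivialisation of $(P,Y)$ is a $U(1)$-bundle $R\to Y$ with an isomorphism $\varphi\colon\delta(R)\to P$ of $U(1)$-bundles over $Y^{[2]}$ that respects the multiplications, and $(P,Y)$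 is trivial if it has a trivialisation. The Dixmier–Douady class $DD(P,Y)\in H^3(M,\mathbb Z)$ (Čech cohomology) is defined as follows. Take an open cover $(U_\alpha)$ of $M$ with smooth sections $s_\alpha\colon U_\alpha\to Y$ of $\pi$, fine enough that there are smooth sections $\sigma_{\alpha\beta}$ of $(s_\alpha,s_\beta)^*P$ over $U_\alpha\cap U_\beta$ and smooth functions $w_{\alpha\beta\gamma}\colon U_\alpha\cap U_\beta\cap U_\gamma\to\mathbb R$ with $m(\sigma_{\alpha\beta},\sigma_{\beta\gamma})=g_{\alpha\beta\gamma}\,\sigma_{\alpha\gamma}$, $g_{\alpha\beta\gamma}=\exp(2\pi i\,w_{\alpha\beta\gamma})$. Then $DD(P,Y)$ is the class of the integer cocycle $w_{\beta\gamma\delta}-w_{\alpha\gamma\delta}+w_{\alpha\beta\delta}-w_{\alpha\beta\gamma}$, that is, the image of $[g_{\alpha\beta\gamma}]$ under $H^2(M,U(1))\cong H^3(M,\mathbb Z)$. Let $(P,Y)$ be a bundle gerbe over $M$. Then the class $DD(P,Y)$ is well defined (such choices exist, and all of them give the same class), and: 1. $(P,Y)$ is trivial if and only if $DD(P,Y)=0$.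 2. If $DD(P,Y)=0$, then any two trivialisations $(R_1,\varphi_1)$, $(R_2,\varphi_2)$ of $(P,Y)$ differ by a $U(1)$-bundle on $M$: there are a $U(1)$-bundle $Q\to M$ and an isomorphism $R_1\cong R_2\otimes\pi^*(Q)$ of $U(1)$-bundles over $Y$ under which $\varphi_1$ corresponds to the composite of the canonical isomorphism $\delta(R_2\otimes\pi^*(Q))\cong\delta(R_2)$ with $\varphi_2$. -/

import Mathlib

open scoped Manifold ContDiff Topology

set_option linter.unusedSectionVars false

noncomputable section

namespace BundleGerbes

universe w

/-! ## `U(1)`-torsors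

The fibres of a principal `U(1)`-bundle: nonempty sets with a free transitive action of the circle
group.  For `p q` in a torsor, `p /ₛ q` is the unique circle element with `(p /ₛ q) • q = p`. -/

/-- A `U(1)`-torsor. -/
structure CircleTorsor : Type (w + 1) where
  /-- the underlying set -/
  carrier : Type w
  /-- the free and transitive circle action -/
  [torsor : Torsor Circle carrier]

instance : CoeSort CircleTorsor.{w} (Type w) := ⟨CircleTorsor.carrier⟩

instance (T : CircleTorsor.{w}) : Torsor Circle T := T.torsor

namespace CircleTorsor

/-- The dual torsor `T*`: the same set, on which `z` acts as `z⁻¹` does on `T`. -/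
def dual (T : CircleTorsor.{w}) : CircleTorsor.{w} where
  carrier := T
  torsor :=
    { smul := fun z p => (z⁻¹ • (p : T) : T)
      one_smul := fun p => by
        change ((1 : Circle)⁻¹ • (p : T) : T) = p
        simp
      mul_smul := fun a b p => by
        change ((a * b)⁻¹ • (p : T) : T) = (a⁻¹ • (b⁻¹ • (p : T)) : T)
        rw [← mul_smul, mul_inv]
      sdiv := fun p q => ((p : T) /ₛ (q : T))⁻¹
      nonempty := T.torsor.nonempty
      sdiv_smul' := fun p q => by
        change ((((p : T) /ₛ (q : T))⁻¹)⁻¹ • (q : T) : T) = p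
        rw [inv_inv, sdiv_smul]
      smul_sdiv' := fun z p => by
        change (((z⁻¹ • (p : T) : T)) /ₛ (p : T))⁻¹ = z
        rw [smul_sdiv, inv_inv] }

/-- The element `p*` of `T*` given by `p : T`. -/
def toDual {T : CircleTorsor.{w}} (p : T) : T.dual := p

/-- The element of `T` underlying an element of `T*`. -/
def ofDual {T : CircleTorsor.{w}} (p : T.dual) : T := p

theorem toDual_sdiv {T : CircleTorsor.{w}} (p q : T) :
    toDual p /ₛ toDual q = (p /ₛ q)⁻¹ := rfl

/-- The equivalence relation `(p, q) ∼ (z p, z⁻¹ q)` on `S × T`. -/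
def tensorSetoid (S T : CircleTorsor.{w}) : Setoid (S × T) where
  r x y := ∃ z : Circle, y.1 = z • x.1 ∧ y.2 = z⁻¹ • x.2
  iseqv :=
    { refl := fun x => ⟨1, by simp, by simp⟩
      symm := by
        rintro x y ⟨z, h1, h2⟩
        exact ⟨z⁻¹, by rw [h1, smul_smul, inv_mul_cancel, one_smul],
          by rw [h2, smul_smul, inv_mul_cancel, one_smul]⟩
      trans := by
        rintro x y t ⟨z, h1, h2⟩ ⟨z', h3, h4⟩
        exact ⟨z' * z, by rw [h3, h1, smul_smul],
          by rw [h4, h2, smul_smul, mul_inv]⟩ }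

/-- The tensor product `S ⊗ T`: the quotient of `S × T` by `(p, q) ∼ (z p, z⁻¹ q)`, with
`z • [p, q] = [z p, q]`. -/
def tensor (S T : CircleTorsor.{w}) : CircleTorsor.{w} where
  carrier := Quotient (tensorSetoid S T)
  torsor :=
    { smul := fun z => Quotient.map (fun x => (z • x.1, x.2)) (by
        rintro x y ⟨t, h1, h2⟩
        exact ⟨t, by simp only [h1, smul_smul, mul_comm], h2⟩)
      one_smul := by
        rintro ⟨x⟩
        exact congrArg (Quotient.mk (tensorSetoid S T)) (Prod.ext (one_smul _ _) rfl)
      mul_smul := by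
        rintro a b ⟨x⟩
        exact congrArg (Quotient.mk (tensorSetoid S T)) (Prod.ext (mul_smul _ _ _) rfl)
      sdiv := Quotient.lift₂ (fun x y : S × T => ((x.1 /ₛ y.1) * (x.2 /ₛ y.2) : Circle)) (by
        rintro x y x' y' ⟨t, h1, h2⟩ ⟨t', h3, h4⟩
        simp only [h1, h2, h3, h4, smul_sdiv_assoc, sdiv_smul_eq_sdiv_div, div_eq_mul_inv, inv_inv]
        generalize (x.1 /ₛ y.1 : Circle) = u
        generalize (x.2 /ₛ y.2 : Circle) = v
        calc u * v = (t * t⁻¹) * (t' * t'⁻¹) * (u * v) := by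
              rw [mul_inv_cancel, mul_inv_cancel, one_mul, one_mul]
          _ = t * u * t'⁻¹ * (t⁻¹ * v * t') := by
              generalize t⁻¹ = r
              generalize t'⁻¹ = r'
              ac_rfl)
      nonempty := by
        obtain ⟨p⟩ := S.torsor.nonempty
        obtain ⟨q⟩ := T.torsor.nonempty
        exact ⟨Quotient.mk _ (p, q)⟩
      sdiv_smul' := by
        rintro ⟨x⟩ ⟨y⟩
        refine Quotient.sound ⟨y.2 /ₛ x.2, ?_, ?_⟩
        · change x.1 = (y.2 /ₛ x.2) • (((x.1 /ₛ y.1) * (x.2 /ₛ y.2)) • y.1)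
          rw [smul_smul, mul_comm (x.1 /ₛ y.1), ← mul_assoc, sdiv_mul_sdiv_cancel, sdiv_self,
            one_mul, sdiv_smul]
        · change x.2 = (y.2 /ₛ x.2)⁻¹ • y.2
          rw [inv_sdiv_eq_sdiv_rev, sdiv_smul]
      smul_sdiv' := by
        rintro z ⟨x⟩
        change ((z • x.1) /ₛ x.1) * (x.2 /ₛ x.2) = z
        rw [smul_sdiv, sdiv_self, mul_one] }

/-- The element `p ⊗ q` of `S ⊗ T`. -/
def tmul {S T : CircleTorsor.{w}} (p : S) (q : T) : S.tensor T :=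
  Quotient.mk (tensorSetoid S T) (p, q)

theorem tmul_sdiv {S T : CircleTorsor.{w}} (p p' : S) (q q' : T) :
    tmul p q /ₛ tmul p' q' = (p /ₛ p') * (q /ₛ q') := rfl

theorem smul_tmul {S T : CircleTorsor.{w}} (z : Circle) (p : S) (q : T) :
    z • tmul p q = tmul (z • p) q := rfl

theorem tmul_surj {S T : CircleTorsor.{w}} (x : S.tensor T) : ∃ p q, x = tmul p q := by
  obtain ⟨⟨p, q⟩, h⟩ := Quotient.exists_rep x
  exact ⟨p, q, h.symm⟩

/-- The contraction `(A ⊗ B*) ⊗ (B ⊗ C*) → A ⊗ C*`,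
which sends `(a ⊗ b*) ⊗ (b ⊗ c*)` to `a ⊗ c*`. -/
def contract {A B C : CircleTorsor.{w}} :
    (A.tensor B.dual).tensor (B.tensor C.dual) → A.tensor C.dual :=
  Quotient.lift (fun x : A.tensor B.dual × B.tensor C.dual =>
    Quotient.lift₂ (fun (u : A × B.dual) (v : B × C.dual) =>
      (v.1 /ₛ ofDual u.2) • (tmul u.1 v.2 : A.tensor C.dual))
      (by
        rintro u v u' v' ⟨t, h1, h2⟩ ⟨t', h3, h4⟩
        have h2' : ofDual u'.2 = t • ofDual u.2 := by
          have := congrArg ofDual h2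
          rw [this]
          change ((t⁻¹)⁻¹ • ofDual u.2 : B) = _
          rw [inv_inv]
        rw [← sdiv_eq_one_iff_eq, smul_sdiv_smul_comm, tmul_sdiv, h1, h2', h3, h4,
          smul_sdiv_assoc, sdiv_smul_eq_sdiv_div, sdiv_smul_eq_sdiv_div, sdiv_smul_eq_sdiv_div,
          sdiv_self, sdiv_self]
        simp only [div_eq_mul_inv, mul_inv, inv_inv, one_mul]
        generalize v.1 /ₛ ofDual u.2 = s
        calc s * (t'⁻¹ * (s⁻¹ * t)) * (t⁻¹ * t')
            = (s * s⁻¹) * (t * t⁻¹) * (t' * t'⁻¹) := by ac_rfl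
          _ = 1 := by simp)
      x.1 x.2)
    (by
      rintro ⟨⟨u⟩, ⟨v⟩⟩ ⟨x', y'⟩ ⟨t, h1, h2⟩
      dsimp only at h1 h2
      subst h1 h2
      change (v.1 /ₛ ofDual u.2) • (tmul u.1 v.2 : A.tensor C.dual) =
        ((t⁻¹ • v.1) /ₛ ofDual u.2) • (tmul (t • u.1) v.2 : A.tensor C.dual)
      rw [smul_sdiv_assoc, ← smul_tmul, smul_smul, mul_comm t⁻¹, mul_assoc, inv_mul_cancel,
        mul_one])

theorem contract_tmul {A B C : CircleTorsor.{w}} (a : A) (b b' : B) (c : C) :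
    contract (tmul (tmul a (toDual b)) (tmul b' (toDual c))) =
      (b' /ₛ b) • (tmul a (toDual c) : A.tensor C.dual) := rfl

theorem contract_smul {A B C : CircleTorsor.{w}} (z : Circle)
    (x : (A.tensor B.dual).tensor (B.tensor C.dual)) : contract (z • x) = z • contract x := by
  obtain ⟨u, v, rfl⟩ := tmul_surj x
  obtain ⟨a, b, rfl⟩ := tmul_surj u
  obtain ⟨b', c, rfl⟩ := tmul_surj v
  change (b' /ₛ ofDual b) • (tmul (z • a) c : A.tensor C.dual) =
    z • ((b' /ₛ ofDual b) • (tmul a c : A.tensor C.dual))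
  rw [← smul_tmul, smul_smul, smul_smul, mul_comm]

theorem contract_assoc {A B C D : CircleTorsor.{w}} (p : A.tensor B.dual) (q : B.tensor C.dual)
    (r : C.tensor D.dual) :
    contract (tmul (contract (tmul p q)) r) = contract (tmul p (contract (tmul q r))) := by
  obtain ⟨a, b, rfl⟩ := tmul_surj p
  obtain ⟨b', c, rfl⟩ := tmul_surj q
  obtain ⟨c', d, rfl⟩ := tmul_surj r
  change (c' /ₛ ofDual c) • (tmul ((b' /ₛ ofDual b) • a) d : A.tensor D.dual) =
    (((c' /ₛ ofDual c) • b') /ₛ ofDual b) • (tmul a d : A.tensor D.dual)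
  rw [← smul_tmul, smul_smul, smul_sdiv_assoc]

theorem contract_sdiv {A B C : CircleTorsor.{w}} (a a' : A) (b b' : B) (c c' : C) :
    contract (tmul (tmul a (toDual b)) (tmul b' (toDual c))) /ₛ
        (tmul a' (toDual c') : A.tensor C.dual) =
      (b' /ₛ b) * ((a /ₛ a') * (c /ₛ c')⁻¹) := by
  rw [contract_tmul, smul_sdiv_assoc, tmul_sdiv, toDual_sdiv]

end CircleTorsor

open CircleTorsor

/-! ## Smooth functions and smooth maps on subspaces of manifolds

The base spaces of our bundles are a manifold itself (`ι = id`), an open subset of a manifold, or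
the fibre products `Y^[p] ⊆ Y^p` (`ι` the inclusion).  A base `B` is therefore given with an
inclusion `ι : B → X` into a manifold `X`, and functions and maps on `B` are smooth if they are
smooth as functions on the subset `ι(B)` of `X`.  For the submanifold `Y^[p]` of `Y^p` (`Y → M`
a submersion) this is smoothness with respect to its submanifold structure. -/

section Bases

variable {E H X B : Type*} [NormedAddCommGroup E] [NormedSpace ℝ E] [TopologicalSpace H]
  [TopologicalSpace X] [ChartedSpace H X] [TopologicalSpace B]
  {E' H' X' B' : Type*} [NormedAddCommGroup E'] [NormedSpace ℝ E'] [TopologicalSpace H']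
  [TopologicalSpace X'] [ChartedSpace H' X'] [TopologicalSpace B']

/-- The `U(1)`-valued function `g` on `B` is smooth on the open subset `U` of `B`. -/
def SmoothOn (I : ModelWithCorners ℝ E H) (ι : B → X) (U : Set B) (g : B → Circle) : Prop :=
  ∃ G : X → Circle, ContMDiffOn I (𝓡 1) ∞ G (ι '' U) ∧ ∀ b ∈ U, g b = G (ι b)

/-- The map `f : B' → B` is smooth. -/
structure IsSmoothMap (I' : ModelWithCorners ℝ E' H') (ι' : B' → X')
    (I : ModelWithCorners ℝ E H) (ι : B → X) (f : B' → B) : Prop where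
  continuous : Continuous f
  smooth : ∃ F : X' → X, ContMDiffOn I' I ∞ F (Set.range ι') ∧ ∀ b, ι (f b) = F (ι' b)

variable {I : ModelWithCorners ℝ E H} {ι : B → X} {I' : ModelWithCorners ℝ E' H'} {ι' : B' → X'}

theorem SmoothOn.mono {U V : Set B} {g : B → Circle} (h : SmoothOn I ι U g) (hV : V ⊆ U) :
    SmoothOn I ι V g := by
  obtain ⟨G, hG, hg⟩ := h
  exact ⟨G, hG.mono (Set.image_mono hV), fun b hb => hg b (hV hb)⟩

theorem SmoothOn.congr {U : Set B} {g g' : B → Circle} (h : SmoothOn I ι U g)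
    (hg' : ∀ b ∈ U, g' b = g b) : SmoothOn I ι U g' := by
  obtain ⟨G, hG, hg⟩ := h
  exact ⟨G, hG, fun b hb => (hg' b hb).trans (hg b hb)⟩

theorem SmoothOn.mul {U : Set B} {g g' : B → Circle} (h : SmoothOn I ι U g)
    (h' : SmoothOn I ι U g') : SmoothOn I ι U (fun b => g b * g' b) := by
  obtain ⟨G, hG, hg⟩ := h
  obtain ⟨G', hG', hg'⟩ := h'
  have : LieGroup (𝓡 1) ∞ Circle := LieGroup.of_le (n := ω) le_top
  exact ⟨fun x => G x * G' x, hG.mul hG', fun b hb => congrArg₂ (· * ·) (hg b hb) (hg' b hb)⟩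

theorem SmoothOn.inv {U : Set B} {g : B → Circle} (h : SmoothOn I ι U g) :
    SmoothOn I ι U (fun b => (g b)⁻¹) := by
  obtain ⟨G, hG, hg⟩ := h
  have : LieGroup (𝓡 1) ∞ Circle := LieGroup.of_le (n := ω) le_top
  exact ⟨fun x => (G x)⁻¹, hG.inv, fun b hb => congrArg (·⁻¹) (hg b hb)⟩

theorem SmoothOn.comp {U : Set B} {g : B → Circle} (h : SmoothOn I ι U g) {f : B' → B}
    (hf : IsSmoothMap I' ι' I ι f) : SmoothOn I' ι' (f ⁻¹' U) (fun b => g (f b)) := by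
  obtain ⟨G, hG, hg⟩ := h
  obtain ⟨F, hF, hf⟩ := hf.smooth
  refine ⟨G ∘ F, hG.comp (hF.mono (Set.image_subset_range _ _)) ?_, fun b hb => ?_⟩
  · rintro _ ⟨b, hb, rfl⟩
    exact ⟨f b, hb, hf b⟩
  · exact (hg _ hb).trans (congrArg G (hf b))

theorem isSmoothMap_of_contMDiff {f : X' → X} (hf : ContMDiff I' I ∞ f) :
    IsSmoothMap I' (id : X' → X') I (id : X → X) f :=
  ⟨hf.continuous, f, hf.contMDiffOn, fun _ => rfl⟩

/-! ## `U(1)`-bundles -/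

/-- A smooth principal `U(1)`-bundle over the base `ι : B → X`: a family of `U(1)`-torsors
(the fibres) and an atlas of local sections, with smooth transition functions.  A member of the
atlas is an open set `e.1` and a section `e.2` over it (the values of `e.2` outside `e.1` play no
role).  The total space has one smooth structure for which the sections in the atlas
are smooth local sections of a principal bundle. -/
structure CircleBundle (I : ModelWithCorners ℝ E H) (ι : B → X) where
  /-- the fibre over a point -/
  fiber : B → CircleTorsor.{w}
  /-- local sections -/
  atlas : Set (Set B × (∀ b, fiber b))
  isOpen : ∀ e ∈ atlas, IsOpen e.1
  cover : ∀ b, ∃ e ∈ atlas, b ∈ e.1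
  smooth : ∀ e ∈ atlas, ∀ e' ∈ atlas, SmoothOn I ι (e.1 ∩ e'.1) (fun b => e.2 b /ₛ e'.2 b)

namespace CircleBundle

/-- The section `s` of `P` is smooth over the open set `U`. -/
def IsSmoothSection (P : CircleBundle.{w} I ι) (U : Set B) (s : ∀ b, P.fiber b) : Prop :=
  ∀ e ∈ P.atlas, SmoothOn I ι (U ∩ e.1) (fun b => s b /ₛ e.2 b)

/-- Isomorphisms of `U(1)`-bundles over the identity of the base: equivariant maps of the fibres
which send smooth local sections to smooth local sections. -/
structure Iso (P Q : CircleBundle.{w} I ι) where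
  /-- the map of the fibres -/
  toFun : ∀ b, P.fiber b → Q.fiber b
  equivariant : ∀ b (z : Circle) (p : P.fiber b), toFun b (z • p) = z • toFun b p
  smooth : ∀ e ∈ P.atlas, Q.IsSmoothSection e.1 (fun b => toFun b (e.2 b))

/-- The dual bundle `P*`. -/
def dual (P : CircleBundle.{w} I ι) : CircleBundle.{w} I ι where
  fiber b := (P.fiber b).dual
  atlas := {e | ∃ u ∈ P.atlas, e = (u.1, fun b => toDual (u.2 b))}
  isOpen := by
    rintro _ ⟨u, hu, rfl⟩
    exact P.isOpen u hu
  cover b := by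
    obtain ⟨u, hu, hb⟩ := P.cover b
    exact ⟨_, ⟨u, hu, rfl⟩, hb⟩
  smooth := by
    rintro _ ⟨u, hu, rfl⟩ _ ⟨v, hv, rfl⟩
    exact (P.smooth u hu v hv).inv

/-- The product bundle `P ⊗ Q`. -/
def tensor (P Q : CircleBundle.{w} I ι) : CircleBundle.{w} I ι where
  fiber b := (P.fiber b).tensor (Q.fiber b)
  atlas := {e | ∃ u ∈ P.atlas, ∃ v ∈ Q.atlas, e = (u.1 ∩ v.1, fun b => tmul (u.2 b) (v.2 b))}
  isOpen := by
    rintro _ ⟨u, hu, v, hv, rfl⟩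
    exact (P.isOpen u hu).inter (Q.isOpen v hv)
  cover b := by
    obtain ⟨u, hu, hb⟩ := P.cover b
    obtain ⟨v, hv, hb'⟩ := Q.cover b
    exact ⟨_, ⟨u, hu, v, hv, rfl⟩, hb, hb'⟩
  smooth := by
    rintro _ ⟨u, hu, v, hv, rfl⟩ _ ⟨u', hu', v', hv', rfl⟩
    exact ((P.smooth u hu u' hu').mono fun b hb => ⟨hb.1.1, hb.2.1⟩).mul
      ((Q.smooth v hv v' hv').mono fun b hb => ⟨hb.1.2, hb.2.2⟩)

/-- The pullback bundle `f*(P)`. -/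
def pullback (P : CircleBundle.{w} I ι) (f : B' → B) (hf : IsSmoothMap I' ι' I ι f) :
    CircleBundle.{w} I' ι' where
  fiber b := P.fiber (f b)
  atlas := {e | ∃ u ∈ P.atlas, e = (f ⁻¹' u.1, fun b => u.2 (f b))}
  isOpen := by
    rintro _ ⟨u, hu, rfl⟩
    exact (P.isOpen u hu).preimage hf.continuous
  cover b := by
    obtain ⟨u, hu, hb⟩ := P.cover (f b)
    exact ⟨_, ⟨u, hu, rfl⟩, hb⟩
  smooth := by
    rintro _ ⟨u, hu, rfl⟩ _ ⟨v, hv, rfl⟩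
    exact (P.smooth u hu v hv).comp hf

end CircleBundle

end Bases

/-! ## Fibre products -/

section FibreProducts

variable {E H Y M : Type*} [NormedAddCommGroup E] [NormedSpace ℝ E] [TopologicalSpace H]
  [TopologicalSpace Y] [ChartedSpace H Y]

/-- The fibre product `Y^[2] = Y ×_M Y`. -/
abbrev Y2 (π : Y → M) : Type _ := {y : Y × Y // π y.1 = π y.2}

/-- The fibre product `Y^[3] = Y ×_M Y ×_M Y`. -/
abbrev Y3 (π : Y → M) : Type _ := {y : Y × Y × Y // π y.1 = π y.2.1 ∧ π y.2.1 = π y.2.2}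

variable (π : Y → M)

/-- `(y₁, y₂) ↦ y₁` -/
def pr1 (y : Y2 π) : Y := y.1.1

/-- `(y₁, y₂) ↦ y₂` -/
def pr2 (y : Y2 π) : Y := y.1.2

/-- `(y₁, y₂, y₃) ↦ (y₁, y₂)` -/
def pr12 (y : Y3 π) : Y2 π := ⟨(y.1.1, y.1.2.1), y.2.1⟩

/-- `(y₁, y₂, y₃) ↦ (y₂, y₃)` -/
def pr23 (y : Y3 π) : Y2 π := ⟨(y.1.2.1, y.1.2.2), y.2.2⟩

/-- `(y₁, y₂, y₃) ↦ (y₁, y₃)` -/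
def pr13 (y : Y3 π) : Y2 π := ⟨(y.1.1, y.1.2.2), y.2.1.trans y.2.2⟩

variable (I : ModelWithCorners ℝ E H)

theorem isSmoothMap_pr1 :
    IsSmoothMap (I.prod I) (Subtype.val : Y2 π → Y × Y) I (id : Y → Y) (pr1 π) :=
  ⟨by unfold pr1; fun_prop, Prod.fst, contMDiff_fst.contMDiffOn, fun _ => rfl⟩

theorem isSmoothMap_pr2 :
    IsSmoothMap (I.prod I) (Subtype.val : Y2 π → Y × Y) I (id : Y → Y) (pr2 π) :=
  ⟨by unfold pr2; fun_prop, Prod.snd, contMDiff_snd.contMDiffOn, fun _ => rfl⟩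

theorem isSmoothMap_pr12 :
    IsSmoothMap (I.prod (I.prod I)) (Subtype.val : Y3 π → Y × Y × Y)
      (I.prod I) (Subtype.val : Y2 π → Y × Y) (pr12 π) :=
  ⟨by unfold pr12; fun_prop, fun y => (y.1, y.2.1),
    (contMDiff_fst.prodMk (contMDiff_fst.comp contMDiff_snd)).contMDiffOn, fun _ => rfl⟩

theorem isSmoothMap_pr23 :
    IsSmoothMap (I.prod (I.prod I)) (Subtype.val : Y3 π → Y × Y × Y)
      (I.prod I) (Subtype.val : Y2 π → Y × Y) (pr23 π) :=
  ⟨by unfold pr23; fun_prop, fun y => (y.2.1, y.2.2),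
    ((contMDiff_fst.comp contMDiff_snd).prodMk
      (contMDiff_snd.comp contMDiff_snd)).contMDiffOn, fun _ => rfl⟩

theorem isSmoothMap_pr13 :
    IsSmoothMap (I.prod (I.prod I)) (Subtype.val : Y3 π → Y × Y × Y)
      (I.prod I) (Subtype.val : Y2 π → Y × Y) (pr13 π) :=
  ⟨by unfold pr13; fun_prop, fun y => (y.1, y.2.2),
    (contMDiff_fst.prodMk (contMDiff_snd.comp contMDiff_snd)).contMDiffOn, fun _ => rfl⟩

/-! ## Bundle gerbes and trivialisations -/

/-- A bundle gerbe `(P, Y)` for `π : Y → M` (a surjective submersion): a `U(1)`-bundle `P` over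
`Y^[2]` with an associative bundle gerbe multiplication `P_(y₁,y₂) ⊗ P_(y₂,y₃) → P_(y₁,y₃)`, a
smooth isomorphism of bundles over `Y^[3]`. -/
structure BundleGerbe where
  /-- the bundle over `Y^[2]` -/
  P : CircleBundle.{w} (I.prod I) (Subtype.val : Y2 π → Y × Y)
  /-- the bundle gerbe multiplication -/
  m : CircleBundle.Iso
    ((P.pullback (pr12 π) (isSmoothMap_pr12 π I)).tensor
      (P.pullback (pr23 π) (isSmoothMap_pr23 π I)))
    (P.pullback (pr13 π) (isSmoothMap_pr13 π I))
  assoc : ∀ (y₁ y₂ y₃ y₄ : Y) (h₁₂ : π y₁ = π y₂) (h₂₃ : π y₂ = π y₃) (h₃₄ : π y₃ = π y₄)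
    (p : P.fiber ⟨(y₁, y₂), h₁₂⟩) (q : P.fiber ⟨(y₂, y₃), h₂₃⟩) (r : P.fiber ⟨(y₃, y₄), h₃₄⟩),
    m.toFun ⟨(y₁, y₃, y₄), h₁₂.trans h₂₃, h₃₄⟩
        (tmul (m.toFun ⟨(y₁, y₂, y₃), h₁₂, h₂₃⟩ (tmul p q)) r) =
      m.toFun ⟨(y₁, y₂, y₄), h₁₂, h₂₃.trans h₃₄⟩
        (tmul p (m.toFun ⟨(y₂, y₃, y₄), h₂₃, h₃₄⟩ (tmul q r)))

variable {π I}

namespace BundleGerbe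

/-- The product `P_(y₁,y₂) × P_(y₂,y₃) → P_(y₁,y₃)` of a bundle gerbe. -/
def mul (G : BundleGerbe.{w} π I) {y₁ y₂ y₃ : Y} (h₁₂ : π y₁ = π y₂) (h₂₃ : π y₂ = π y₃)
    (p : G.P.fiber ⟨(y₁, y₂), h₁₂⟩) (q : G.P.fiber ⟨(y₂, y₃), h₂₃⟩) :
    G.P.fiber ⟨(y₁, y₃), h₁₂.trans h₂₃⟩ :=
  G.m.toFun ⟨(y₁, y₂, y₃), h₁₂, h₂₃⟩ (tmul p q)

/-- Isomorphisms of bundle gerbes for the same `Y → M`: isomorphisms of the bundles over `Y^[2]`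
which respect the multiplications. -/
structure Iso (G G' : BundleGerbe.{w} π I) extends CircleBundle.Iso G.P G'.P where
  map_mul : ∀ (y₁ y₂ y₃ : Y) (h₁₂ : π y₁ = π y₂) (h₂₃ : π y₂ = π y₃)
    (p : G.P.fiber ⟨(y₁, y₂), h₁₂⟩) (q : G.P.fiber ⟨(y₂, y₃), h₂₃⟩),
    toFun ⟨(y₁, y₃), h₁₂.trans h₂₃⟩ (G.mul h₁₂ h₂₃ p q) =
      G'.mul h₁₂ h₂₃ (toFun ⟨(y₁, y₂), h₁₂⟩ p) (toFun ⟨(y₂, y₃), h₂₃⟩ q)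

/-- The bundle gerbe `(δ(R), Y)` of a `U(1)`-bundle `R → Y`:
`δ(R)_(y₁,y₂) = R_(y₁) ⊗ R_(y₂)*`, with the contraction
`R_(y₁) ⊗ R_(y₂)* ⊗ R_(y₂) ⊗ R_(y₃)* → R_(y₁) ⊗ R_(y₃)*` as multiplication. -/
def delta (π : Y → M) {I : ModelWithCorners ℝ E H} (R : CircleBundle.{w} I (id : Y → Y)) :
    BundleGerbe.{w} π I where
  P := (R.pullback (pr1 π) (isSmoothMap_pr1 π I)).tensor
    (R.pullback (pr2 π) (isSmoothMap_pr2 π I)).dual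
  m :=
    { toFun := fun _ => contract
      equivariant := fun _ z x => contract_smul z x
      smooth := by
        rintro _ ⟨_, ⟨_, ⟨_, ⟨a, ha, rfl⟩, _, ⟨_, ⟨b, hb, rfl⟩, rfl⟩, rfl⟩, rfl⟩,
          _, ⟨_, ⟨_, ⟨b', hb', rfl⟩, _, ⟨_, ⟨c, hc, rfl⟩, rfl⟩, rfl⟩, rfl⟩, rfl⟩
          _ ⟨_, ⟨_, ⟨a', ha', rfl⟩, _, ⟨_, ⟨c', hc', rfl⟩, rfl⟩, rfl⟩, rfl⟩
        have h12 := isSmoothMap_pr12 π I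
        have h23 := isSmoothMap_pr23 π I
        have h13 := isSmoothMap_pr13 π I
        have k1 := (((R.smooth b' hb' b hb).comp (isSmoothMap_pr1 π I)).comp h23)
        have k2 := (((R.smooth a ha a' ha').comp (isSmoothMap_pr1 π I)).comp h13)
        have k3 := (((R.smooth c hc c' hc').comp (isSmoothMap_pr2 π I)).comp h13).inv
        refine SmoothOn.congr (((k1.mono ?_).mul ((k2.mono ?_).mul (k3.mono ?_)))) ?_
        · rintro y ⟨⟨⟨h1, h2⟩, h3, h4⟩, h5, h6⟩
          exact ⟨h3, h2⟩
        · rintro y ⟨⟨⟨h1, h2⟩, h3, h4⟩, h5, h6⟩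
          exact ⟨h1, h5⟩
        · rintro y ⟨⟨⟨h1, h2⟩, h3, h4⟩, h5, h6⟩
          exact ⟨h4, h6⟩
        · intro y _
          exact contract_sdiv _ _ _ _ _ _ }
  assoc := fun _ _ _ _ _ _ _ p q r => contract_assoc p q r

/-- A trivialisation of `(P, Y)`: a `U(1)`-bundle `R → Y` and an isomorphism of bundle gerbes
`(δ(R), Y) ≃ (P, Y)`. -/
structure Trivialisation (G : BundleGerbe.{w} π I) where
  /-- the bundle over `Y` -/
  R : CircleBundle.{w} I (id : Y → Y)
  /-- the isomorphism -/
  iso : Iso (delta π R) G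

/-- The bundle gerbe is trivial. -/
def IsTrivial (G : BundleGerbe.{w} π I) : Prop := Nonempty G.Trivialisation

end BundleGerbe

end FibreProducts

/-! ## Čech cohomology with integer coefficients -/

section Cech

/-- An open cover of `M`, indexed by the points of `M`, with `x ∈ U x`.  Every open cover is
refined by such a cover, so that these covers compute Čech cohomology. -/
structure PointedCover (M : Type*) [TopologicalSpace M] where
  /-- the open sets -/
  U : M → Set M
  isOpen : ∀ x, IsOpen (U x)
  mem : ∀ x, x ∈ U x

variable {M : Type*} [TopologicalSpace M]

namespace PointedCover

/-- `𝒰 ≤ 𝒱` if `𝒱` is finer than `𝒰`. -/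
instance : Preorder (PointedCover M) where
  le 𝒰 𝒱 := ∀ x, 𝒱.U x ⊆ 𝒰.U x
  le_refl _ _ := subset_rfl
  le_trans _ _ _ h h' x := (h' x).trans (h x)

instance : Nonempty (PointedCover M) :=
  ⟨⟨fun _ => Set.univ, fun _ => isOpen_univ, fun _ => Set.mem_univ _⟩⟩

instance : IsDirectedOrder (PointedCover M) :=
  ⟨fun 𝒰 𝒱 => ⟨⟨fun x => 𝒰.U x ∩ 𝒱.U x, fun x => (𝒰.isOpen x).inter (𝒱.isOpen x),
    fun x => ⟨𝒰.mem x, 𝒱.mem x⟩⟩, fun _ => Set.inter_subset_left, fun _ => Set.inter_subset_right⟩⟩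

/-- The intersection of the sets `U (i 0), …, U (i (k - 1))`. -/
def inter (𝒰 : PointedCover M) {k : ℕ} (i : Fin k → M) : Set M := {x | ∀ a, x ∈ 𝒰.U (i a)}

/-- Čech cochains of degree `k` with values in the sheaf of locally constant integer-valued
functions. -/
abbrev Cochain (𝒰 : PointedCover M) (k : ℕ) : Type _ :=
  ∀ i : Fin (k + 1) → M, LocallyConstant (𝒰.inter i) ℤ

/-- The inclusion of `U_(i 0) ∩ … ∩ U_(i (k + 1))` in the intersection without the set `a`. -/
def faceIncl (𝒰 : PointedCover M) {k : ℕ} (i : Fin (k + 1) → M) (a : Fin (k + 1)) :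
    C(𝒰.inter i, 𝒰.inter (i ∘ a.succAbove)) :=
  ⟨fun x => ⟨x.1, fun b => x.2 (a.succAbove b)⟩, by fun_prop⟩

/-- The Čech coboundary
`(d c)_(i 0, …, i (k + 1)) = ∑ a, (-1)^a c_(i 0, …, omit i a, …, i (k + 1))`. -/
def d (𝒰 : PointedCover M) (k : ℕ) : 𝒰.Cochain k →+ 𝒰.Cochain (k + 1) where
  toFun c i := ∑ a : Fin (k + 2), (-1 : ℤ) ^ (a : ℕ) • (c (i ∘ a.succAbove)).comap (𝒰.faceIncl i a)
  map_zero' := by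
    funext i
    refine Finset.sum_eq_zero fun a _ => ?_
    ext x
    simp
  map_add' c c' := by
    funext i
    refine Eq.trans (Finset.sum_congr rfl fun a _ => ?_) Finset.sum_add_distrib
    ext x
    simp [mul_add]

/-- Čech cocycles. -/
abbrev cocycles (𝒰 : PointedCover M) (k : ℕ) : AddSubgroup (𝒰.Cochain k) := (𝒰.d k).ker

/-- Čech coboundaries. -/
def coboundaries (𝒰 : PointedCover M) : (k : ℕ) → AddSubgroup (𝒰.Cochain k)
  | 0 => ⊥
  | k + 1 => (𝒰.d k).range

/-- The Čech cohomology `H^k(𝒰, ℤ)` of the cover. -/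
abbrev H (𝒰 : PointedCover M) (k : ℕ) : Type _ :=
  𝒰.cocycles k ⧸ (𝒰.coboundaries k).addSubgroupOf (𝒰.cocycles k)

variable {𝒰 𝒱 𝒲 : PointedCover M}

/-- The inclusion of the intersections for a finer cover. -/
def refineIncl (h : 𝒰 ≤ 𝒱) {k : ℕ} (i : Fin k → M) : C(𝒱.inter i, 𝒰.inter i) :=
  ⟨fun x => ⟨x.1, fun b => h (i b) (x.2 b)⟩, by fun_prop⟩

/-- Restriction of cochains to a finer cover. -/
def res (h : 𝒰 ≤ 𝒱) (k : ℕ) : 𝒰.Cochain k →+ 𝒱.Cochain k where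
  toFun c i := (c i).comap (refineIncl h i)
  map_zero' := rfl
  map_add' _ _ := rfl

theorem d_apply {k : ℕ} (c : 𝒰.Cochain k) (i : Fin (k + 2) → M) (x : 𝒰.inter i) :
    𝒰.d k c i x = ∑ a : Fin (k + 2), (-1 : ℤ) ^ (a : ℕ) *
      c (i ∘ a.succAbove) (𝒰.faceIncl i a x) := by
  change (∑ a : Fin (k + 2),
    (-1 : ℤ) ^ (a : ℕ) • (c (i ∘ a.succAbove)).comap (𝒰.faceIncl i a)) x = _
  rw [← LocallyConstant.coeFnAddMonoidHom_apply, map_sum, Finset.sum_apply]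
  rfl

theorem res_d (h : 𝒰 ≤ 𝒱) (k : ℕ) (c : 𝒰.Cochain k) :
    res h (k + 1) (𝒰.d k c) = 𝒱.d k (res h k c) := by
  funext i
  ext x
  rw [d_apply]
  exact d_apply c i (refineIncl h i x)

/-- Restriction of cocycles to a finer cover. -/
def resCocycles (h : 𝒰 ≤ 𝒱) (k : ℕ) : 𝒰.cocycles k →+ 𝒱.cocycles k :=
  ((res h k).comp (𝒰.cocycles k).subtype).codRestrict _ fun c => by
    change 𝒱.d k (res h k c.1) = 0
    rw [← res_d, (AddMonoidHom.mem_ker).1 c.2, map_zero]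

theorem coboundaries_le (h : 𝒰 ≤ 𝒱) (k : ℕ) :
    (𝒰.coboundaries k).addSubgroupOf (𝒰.cocycles k) ≤
      ((𝒱.coboundaries k).addSubgroupOf (𝒱.cocycles k)).comap (resCocycles h k) := by
  rintro ⟨c, hc⟩ hb
  change c ∈ 𝒰.coboundaries k at hb
  change res h k c ∈ 𝒱.coboundaries k
  cases k with
  | zero =>
    have hb' : c = 0 := hb
    rw [hb', map_zero]
    exact zero_mem _
  | succ k =>
    obtain ⟨b, rfl⟩ := hb
    exact ⟨res h k b, (res_d h k b).symm⟩

/-- The refinement map `H^k(𝒰, ℤ) → H^k(𝒱, ℤ)`. -/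
def resH (k : ℕ) (𝒰 𝒱 : PointedCover M) (h : 𝒰 ≤ 𝒱) : 𝒰.H k →+ 𝒱.H k :=
  QuotientAddGroup.map _ _ (resCocycles h k) (coboundaries_le h k)

instance (k : ℕ) : DirectedSystem (fun 𝒰 : PointedCover M => 𝒰.H k) (resH k · · ·) where
  map_self := by
    rintro 𝒰 ⟨c⟩
    rfl
  map_map := by
    rintro 𝒲 𝒱 𝒰 h h' ⟨c⟩
    rfl

end PointedCover

/-- The Čech cohomology `H^k(M, ℤ)`: the direct limit of `H^k(𝒰, ℤ)` over the open covers. -/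
abbrev CechH (M : Type*) [TopologicalSpace M] (k : ℕ) : Type _ :=
  DirectLimit (fun 𝒰 : PointedCover M => 𝒰.H k) (PointedCover.resH k)

/-- The cohomology class of a Čech cocycle. -/
def cechClass (𝒰 : PointedCover M) (k : ℕ) (c : 𝒰.cocycles k) : CechH M k :=
  ⟦⟨𝒰, (QuotientAddGroup.mk c : 𝒰.H k)⟩⟧

end Cech

/-! ## The Dixmier–Douady class -/

section DixmierDouady

variable {E H Y F K M : Type*} [NormedAddCommGroup E] [NormedSpace ℝ E] [TopologicalSpace H]
  [TopologicalSpace Y] [ChartedSpace H Y]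
  [NormedAddCommGroup F] [NormedSpace ℝ F] [TopologicalSpace K]
  [TopologicalSpace M] [ChartedSpace K M]

/-- An open cover `(U_a)` of `M` and smooth sections `s_a : U_a → Y` of `π : Y → M`
(the values of `s_a` outside `U_a` play no role). -/
structure LocalSections (π : Y → M) (I : ModelWithCorners ℝ E H) (J : ModelWithCorners ℝ F K) where
  /-- the cover -/
  cover : PointedCover M
  /-- the sections -/
  s : M → M → Y
  smooth : ∀ a, ContMDiffOn J I ∞ (s a) (cover.U a)
  proj : ∀ a, ∀ x ∈ cover.U a, π (s a x) = x

namespace LocalSections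

variable {π : Y → M} {I : ModelWithCorners ℝ E H} {J : ModelWithCorners ℝ F K}
  (L : LocalSections π I J)

/-- The overlap `U_a ∩ U_b`. -/
abbrev overlap (a b : M) : Set M := L.cover.U a ∩ L.cover.U b

theorem fiber_eq {a b x : M} (ha : x ∈ L.cover.U a) (hb : x ∈ L.cover.U b) :
    π (L.s a x) = π (L.s b x) :=
  (L.proj a x ha).trans (L.proj b x hb).symm

/-- The map `(s_a, s_b) : U_a ∩ U_b → Y^[2]`. -/
def pair (a b : M) (x : L.overlap a b) : Y2 π :=
  ⟨(L.s a x, L.s b x), L.fiber_eq x.2.1 x.2.2⟩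

theorem isSmoothMap_pair (a b : M) :
    IsSmoothMap J (Subtype.val : L.overlap a b → M)
      (I.prod I) (Subtype.val : Y2 π → Y × Y) (L.pair a b) := by
  have h : ContMDiffOn J (I.prod I) ∞ (fun x => (L.s a x, L.s b x)) (L.overlap a b) :=
    ((L.smooth a).mono Set.inter_subset_left).prodMk ((L.smooth b).mono Set.inter_subset_right)
  refine ⟨Continuous.subtype_mk (continuousOn_iff_continuous_domRestrict.1 h.continuousOn) _,
    fun x => (L.s a x, L.s b x), h.mono ?_, fun _ => rfl⟩
  rw [Subtype.range_coe]

end LocalSections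

namespace BundleGerbe

variable {π : Y → M} {I : ModelWithCorners ℝ E H}

/-- The class `c` in `H³(M, ℤ)` is the Dixmier–Douady class of the bundle gerbe, as computed from
an open cover `(U_a)` with local sections `s_a : U_a → Y`, smooth sections `σ_ab` of
`(s_a, s_b)*(P)` over `U_a ∩ U_b`, the `U(1)`-valued cocycle `g_abc` over `U_a ∩ U_b ∩ U_c` with
`m(σ_ab, σ_bc) = g_abc σ_ac`, and its image under the connecting map
`H²(M, U(1)) → H³(M, ℤ)` of the exponential sequence: smooth real-valued functions `w_abc` over
`U_a ∩ U_b ∩ U_c` with `exp(2πi w_abc) = g_abc`, and the integer cocycle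
`n_abcd = w_bcd - w_acd + w_abd - w_abc`. -/
def IsDDClass (G : BundleGerbe.{w} π I) (J : ModelWithCorners ℝ F K) (c : CechH M 3) : Prop :=
  ∃ (L : LocalSections π I J)
    (σ : ∀ a b (x : L.overlap a b), G.P.fiber (L.pair a b x))
    (g : M → M → M → M → Circle) (w : M → M → M → M → ℝ) (n : L.cover.cocycles 3),
    (∀ a b, (G.P.pullback (L.pair a b) (L.isSmoothMap_pair a b)).IsSmoothSection
      Set.univ (σ a b)) ∧
    (∀ (a b c x : M) (ha : x ∈ L.cover.U a) (hb : x ∈ L.cover.U b) (hc : x ∈ L.cover.U c),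
      G.mul (L.fiber_eq ha hb) (L.fiber_eq hb hc) (σ a b ⟨x, ha, hb⟩) (σ b c ⟨x, hb, hc⟩) =
        g a b c x • σ a c ⟨x, ha, hc⟩) ∧
    (∀ a b c, ContMDiffOn J 𝓘(ℝ, ℝ) ∞ (w a b c)
      (L.cover.U a ∩ L.cover.U b ∩ L.cover.U c)) ∧
    (∀ a b c, ∀ x ∈ L.cover.U a ∩ L.cover.U b ∩ L.cover.U c,
      Circle.exp (2 * Real.pi * w a b c x) = g a b c x) ∧
    (∀ (i : Fin 4 → M) (x : L.cover.inter i),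
      ((n.1 i x : ℤ) : ℝ) = w (i 1) (i 2) (i 3) x - w (i 0) (i 2) (i 3) x
        + w (i 0) (i 1) (i 3) x - w (i 0) (i 1) (i 2) x) ∧
    c = cechClass L.cover 3 n

/-- The Dixmier–Douady class in `H³(M, ℤ)` of the bundle gerbe: the unique class with
`IsDDClass`. -/
def DD (G : BundleGerbe.{w} π I) (J : ModelWithCorners ℝ F K) : CechH M 3 :=
  Classical.epsilon fun c => G.IsDDClass J c

/-- Two trivialisations `(R₁, φ₁)` and `(R₂, φ₂)` differ by the `U(1)`-bundle `Q → M`: there is an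
isomorphism `f : R₁ ≃ R₂ ⊗ π*(Q)` under which `φ₁` is `φ₂` composed with the canonical isomorphism
`δ(R₂ ⊗ π*(Q)) ≃ δ(R₂)`, `(p₁ ⊗ t) ⊗ (p₂ ⊗ t)* ↦ p₁ ⊗ p₂*`. -/
def Trivialisation.DifferBy {G : BundleGerbe.{w} π I} {J : ModelWithCorners ℝ F K}
    (T₁ T₂ : G.Trivialisation) (hπ : ContMDiff I J ∞ π)
    (Q : CircleBundle.{w} J (id : M → M)) : Prop :=
  ∃ f : CircleBundle.Iso T₁.R (T₂.R.tensor (Q.pullback π (isSmoothMap_of_contMDiff hπ))),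
    ∀ (y₁ y₂ : Y) (h : π y₁ = π y₂) (r₁ : T₁.R.fiber y₁) (r₂ : T₁.R.fiber y₂)
      (p₁ : T₂.R.fiber y₁) (p₂ : T₂.R.fiber y₂) (t : Q.fiber (π y₁)),
      f.toFun y₁ r₁ = tmul p₁ t → f.toFun y₂ r₂ = tmul p₂ (h ▸ t : Q.fiber (π y₂)) →
      T₁.iso.toFun ⟨(y₁, y₂), h⟩ (tmul r₁ (toDual r₂)) =
        T₂.iso.toFun ⟨(y₁, y₂), h⟩ (tmul p₁ (toDual p₂))

end BundleGerbe

end DixmierDouady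

end BundleGerbes

end

set_option linter.unusedSectionVars false

noncomputable section

namespace BundleGerbes

universe w

open CircleTorsor

/-! ## Refinements, local sections and local logarithms -/

/-! Without smoothness every bundle gerbe is trivial: rescaling arbitrary elements of the fibres by
means of a set-theoretic section of `π`, associativity gives a multiplicative section `q` of `P`
(`nonempty_mulSection`). Measured against `q`, sections of `P` are circle-valued functions and the
gerbe multiplication is multiplication in the circle; the geometry survives only in the question
which functions count as smooth. `GerbeCharts` and `TrivialisationCharts` record this,
`isDDClass_iff` and `isTrivial_iff` translate both notions, and the rest is Čech theory with
circle-valued functions.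

The choices exist because a submersion has local sections, and because a locally finite shrinking
lets sections and logarithms found near points be chosen on whole overlaps (`exists_refinement`).
Two sets of choices are compared by sections of `P` between the two families of local sections of
`π`. On a fine enough cover the comparison has real logarithms `l`, and `w' - w - δl` is an integer
cochain whose coboundary is `n' - n` (`DDData.cechClass_eq`).

A trivialisation, evaluated along the `s_a`, gives strictly multiplicative sections over the
overlaps, so `w = 0` is allowed. Conversely, if `n = δb` on a finer cover, then `w - b` is a cocycle
of smooth real functions; a partition of unity gives `w - b = δv`, and the sections multiplied by
`exp(-2πi v)` are strictly multiplicative. With them the bundles with fibres `P_(y, s_a(π y))` glue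
to a trivialisation.

Finally, two trivialisations induce over `(y₁, y₂)` two sections of the same `P`. Their smooth
quotient has the form `f(y₁) / f'(y₂)`, where `f` and `f'` are local functions of `R₁ ⊗ R₂*`. This
is descent data for `R₁ ⊗ R₂*`, and pulling back along local sections of `π` gives `Q`
(`contMDiffWithinAt_difference`). -/

/-- An open cover of a paracompact Hausdorff space has a refinement `𝒱`, with `𝒱.U x ⊆ 𝒰.U (k x)`,
such that on every `𝒱.U x` any local property indexed by the members of `𝒰` that meet it holds. -/
theorem PointedCover.exists_refinement {M : Type*} [TopologicalSpace M] [T2Space M]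
    [ParacompactSpace M] (𝒰 : PointedCover M) (N : M → M → M → M → Set M)
    (hN : ∀ x i j l, x ∈ 𝒰.U i → x ∈ 𝒰.U j → x ∈ 𝒰.U l → N x i j l ∈ 𝓝 x) :
    ∃ (𝒱 : PointedCover M) (k : M → M), 𝒰 ≤ 𝒱 ∧ (∀ x, 𝒱.U x ⊆ 𝒰.U (k x)) ∧
      ∀ x y z, (𝒱.U x ∩ 𝒱.U y).Nonempty → (𝒱.U x ∩ 𝒱.U z).Nonempty →
        𝒱.U x ⊆ N x (k x) (k y) (k z) := by
  obtain ⟨v, vo, vc, vf, vU⟩ := precise_refinement 𝒰.U 𝒰.isOpen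
    (Set.iUnion_eq_univ_iff.2 fun x => ⟨x, 𝒰.mem x⟩)
  obtain ⟨W, Wc, Wo, Wv⟩ := exists_iUnion_eq_closure_subset vo (fun x => vf.point_finite x) vc
  have Wf : LocallyFinite fun i => closure (W i) := vf.subset Wv
  choose k hk using Set.iUnion_eq_univ_iff.1 Wc
  have hWU : ∀ i, closure (W i) ⊆ 𝒰.U i := fun i => (Wv i).trans (vU i)
  -- Local finiteness enters twice: only finitely many closures contain `x`, so the intersection of
  -- the `N` is a neighbourhood, and all other closures can be removed at once. After this removal a
  -- set that meets the one at `x` has its index among those finitely many.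
  have hnhds : ∀ x, (W (k x) ∩ 𝒰.U x) ∩
      ((⋂ i ∈ {i | x ∈ closure (W i)}, ⋂ j ∈ {j | x ∈ closure (W j)}, N x (k x) i j) ∩
      ⋂ (i) (_ : x ∉ closure (W i)), (closure (W i))ᶜ) ∈ 𝓝 x := by
    intro x
    refine Filter.inter_mem (((Wo _).inter (𝒰.isOpen x)).mem_nhds ⟨hk x, 𝒰.mem x⟩)
      (Filter.inter_mem ?_ (Wf.iInter_compl_mem_nhds (fun _ => isClosed_closure) x))
    refine (Filter.biInter_mem (Wf.point_finite x)).2 fun i hi =>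
      (Filter.biInter_mem (Wf.point_finite x)).2 fun j hj =>
        hN _ _ _ _ (hWU _ (subset_closure (hk x))) (hWU _ hi) (hWU _ hj)
  have key : ∀ x y p, p ∈ (⋂ (i) (_ : x ∉ closure (W i)), (closure (W i))ᶜ) → p ∈ W (k y) →
      x ∈ closure (W (k y)) := by
    intro x y p hp hy
    by_contra hx
    exact Set.mem_iInter₂.1 hp _ hx (subset_closure hy)
  refine ⟨⟨fun x => interior _, fun x => isOpen_interior,
    fun x => mem_interior_iff_mem_nhds.2 (hnhds x)⟩, k, fun x p hp => (interior_subset hp).1.2,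
    fun x p hp => hWU _ (subset_closure (interior_subset hp).1.1), ?_⟩
  rintro x y z ⟨p, hpx, hpy⟩ ⟨q, hqx, hqz⟩ r hr
  have h1 := key x y p (interior_subset hpx).2.2 (interior_subset hpy).1.1
  have h2 := key x z q (interior_subset hqx).2.2 (interior_subset hqz).1.1
  exact Set.mem_iInter₂.1 (Set.mem_iInter₂.1 (interior_subset hr).2.1 _ h1) _ h2

/-- A submersion has local sections. -/
theorem exists_localSection {E H Y F K M : Type*} [NormedAddCommGroup E] [NormedSpace ℝ E]
    [TopologicalSpace H] [TopologicalSpace Y] [ChartedSpace H Y]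
    [NormedAddCommGroup F] [NormedSpace ℝ F] [TopologicalSpace K]
    [TopologicalSpace M] [ChartedSpace K M]
    {I : ModelWithCorners ℝ E H} [I.Boundaryless] {J : ModelWithCorners ℝ F K}
    {π : Y → M} {p : Y} (h : Manifold.IsSubmersionAt I J ∞ π p) :
    ∃ (V : Set M) (s : M → Y), IsOpen V ∧ π p ∈ V ∧ ContMDiffOn J I ∞ s V ∧
      ∀ x ∈ V, π (s x) = x := by
  set φ := h.domChart
  set ψ := h.codChart
  set e := h.equiv
  set v₀ := (e (φ.extend I p)).2
  have hp : p ∈ (φ.extend I).source := by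
    rw [φ.extend_source]
    exact h.mem_domChart_source
  have hwr := h.writtenInCharts
  -- In the charts `π` is a projection from a product. The section freezes the complementary
  -- coordinate at its value `v₀` at `p`.
  set f : M → E := fun x => e.symm (ψ.extend J x, v₀) with hf
  have hfc : ContMDiffOn J 𝓘(ℝ, E) ∞ f ψ.source := by
    have h1 : ContMDiffOn J 𝓘(ℝ, F) ∞ (ψ.extend J) ψ.source :=
      ψ.contMDiffOn_extend h.codChart_mem_maximalAtlas
    have h2 : ContMDiff 𝓘(ℝ, F) 𝓘(ℝ, E) ∞ (fun u : F => e.symm (u, v₀)) := by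
      rw [contMDiff_iff_contDiff]
      fun_prop
    exact h2.comp_contMDiffOn h1
  have hπp : f (π p) = φ.extend I p := by
    have h1 : ψ.extend J (π p) = (e (φ.extend I p)).1 := by
      have := hwr ((φ.extend I).map_source hp)
      simp only [Function.comp_apply] at this
      rwa [(φ.extend I).left_inv hp] at this
    rw [hf]
    simp only [h1, v₀, Prod.mk.eta, ContinuousLinearEquiv.symm_apply_apply]
  have hsrc : π p ∈ ψ.source := h.source_subset_preimage_source h.mem_domChart_source
  refine ⟨ψ.source ∩ f ⁻¹' (φ.extend I).target, fun x => (φ.extend I).symm (f x),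
    hfc.continuousOn.isOpen_inter_preimage ψ.open_source φ.isOpen_extend_target,
    ⟨hsrc, ?_⟩, ?_, ?_⟩
  · rw [Set.mem_preimage, hπp]
    exact (φ.extend I).map_source hp
  · have h3 := contMDiffOn_extend_symm h.domChart_mem_maximalAtlas (I := I)
    rw [← φ.extend_target'] at h3
    exact h3.comp (hfc.mono Set.inter_subset_left) fun x hx => hx.2
  · rintro x ⟨hx, hx'⟩
    have h4 := hwr hx'
    have h5 : (φ.extend I).symm (f x) ∈ φ.source := by
      have := (φ.extend I).map_target hx'
      rwa [φ.extend_source] at this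
    have h6 := h.source_subset_preimage_source h5
    refine (ψ.extend J).injOn (x₁ := π ((φ.extend I).symm (f x))) (x₂ := x) ?_ ?_ ?_
    · rw [ψ.extend_source]
      exact h6
    · rw [ψ.extend_source]
      exact hx
    · have h7 : ψ.extend J (π ((φ.extend I).symm (f x))) = (e (f x)).1 := h4
      rw [h7]
      simp [hf]

instance : LieGroup (𝓡 1) ∞ Circle := LieGroup.of_le (n := ω) le_top

section Log

variable {F K M : Type*} [NormedAddCommGroup F] [NormedSpace ℝ F] [TopologicalSpace K]
  {J : ModelWithCorners ℝ F K} [TopologicalSpace M] [ChartedSpace K M]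

theorem contMDiff_circle_coe : ContMDiff (𝓡 1) 𝓘(ℝ, ℂ) ∞ (fun z : Circle => (z : ℂ)) :=
  haveI := finrank_real_complex_fact'
  contMDiff_coe_sphere (E := ℂ) (n := 1)

theorem contMDiffAt_circle_arg {z : Circle} (hz : (z : ℂ) ∈ Complex.slitPlane) :
    ContMDiffAt (𝓡 1) 𝓘(ℝ, ℝ) ∞ (fun z : Circle => Complex.arg z) z := by
  have h1 : ContDiffAt ℝ ∞ (fun u : ℂ => (Complex.log u).im) (z : ℂ) :=
    Complex.imCLM.contDiff.contDiffAt.comp _ ((Complex.contDiffAt_log hz).restrict_scalars ℝ)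
  have h2 := h1.contMDiffAt.comp z (contMDiff_circle_coe z)
  exact h2.congr_of_eventuallyEq (Filter.Eventually.of_forall fun u => (Complex.log_im _).symm)

/-- A smooth circle-valued function has local smooth logarithms. -/
theorem exists_local_log {W : Set M} (hW : IsOpen W) {g : M → Circle}
    (hg : ContMDiffOn J (𝓡 1) ∞ g W) {x : M} (hx : x ∈ W) :
    ∃ (N : Set M) (w : M → ℝ), N ∈ 𝓝 x ∧ ContMDiffOn J 𝓘(ℝ, ℝ) ∞ w N ∧
      ∀ y ∈ N, Circle.exp (2 * Real.pi * w y) = g y := by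
  -- Division by `g x` moves the value at `x` to `1`, away from the branch cut of the argument.
  have hq : ContMDiffOn J (𝓡 1) ∞ (fun y => g y * (g x)⁻¹) W :=
    hg.mul contMDiffOn_const
  have hqc : ContinuousOn (fun y => ((g y * (g x)⁻¹ : Circle) : ℂ)) W :=
    continuous_subtype_val.comp_continuousOn hq.continuousOn
  have hpi : (2 * Real.pi) ≠ 0 := by positivity
  refine ⟨W ∩ (fun y => ((g y * (g x)⁻¹ : Circle) : ℂ)) ⁻¹' Complex.slitPlane,
    fun y => (2 * Real.pi)⁻¹ *
      (Complex.arg (g y * (g x)⁻¹ : Circle) + Complex.arg (g x)), ?_, ?_, ?_⟩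
  · refine (hqc.isOpen_inter_preimage hW Complex.isOpen_slitPlane).mem_nhds ⟨hx, ?_⟩
    simp
  · intro y hy
    have h1 : ContMDiffWithinAt J 𝓘(ℝ, ℝ) ∞ (fun y => Complex.arg (g y * (g x)⁻¹ : Circle))
        (W ∩ (fun y => ((g y * (g x)⁻¹ : Circle) : ℂ)) ⁻¹' Complex.slitPlane) y :=
      (contMDiffAt_circle_arg hy.2).comp_contMDiffWithinAt y
        ((hq y hy.1).mono Set.inter_subset_left)
    have h2 : ContMDiff 𝓘(ℝ, ℝ) 𝓘(ℝ, ℝ) ∞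
        (fun u : ℝ => (2 * Real.pi)⁻¹ * (u + Complex.arg (g x))) := by
      rw [contMDiff_iff_contDiff]
      fun_prop
    exact (h2 _).comp_contMDiffWithinAt y h1
  · intro y _
    rw [mul_inv_cancel_left₀ hpi, Circle.exp_add, Circle.exp_arg, Circle.exp_arg,
      inv_mul_cancel_right]

theorem ContMDiffOn.circleExp {W : Set M} {w : M → ℝ} (hw : ContMDiffOn J 𝓘(ℝ, ℝ) ∞ w W) :
    ContMDiffOn J (𝓡 1) ∞ (fun x => Circle.exp (2 * Real.pi * w x)) W := by
  have h2 : ContMDiff 𝓘(ℝ, ℝ) 𝓘(ℝ, ℝ) ∞ (fun u : ℝ => 2 * Real.pi * u) := by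
    rw [contMDiff_iff_contDiff]
    fun_prop
  exact (contMDiff_circleExp.comp h2).comp_contMDiffOn hw

end Log

theorem exp_two_pi_mul_eq_one {r : ℝ} :
    Circle.exp (2 * Real.pi * r) = 1 ↔ ∃ n : ℤ, (n : ℝ) = r := by
  have hpi : (2 * Real.pi) ≠ 0 := by positivity
  rw [Circle.exp_eq_one]
  refine exists_congr fun n => ?_
  rw [mul_comm, eq_comm]
  exact mul_left_inj' hpi

/-- A continuous real function with integer values as a locally constant function. -/
theorem exists_locallyConstant {X : Type*} [TopologicalSpace X] (f : X → ℝ) (hf : Continuous f)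
    (hn : ∀ x, Circle.exp (2 * Real.pi * f x) = 1) :
    ∃ n : LocallyConstant X ℤ, ∀ x, (n x : ℝ) = f x := by
  choose n hn using fun x => exp_two_pi_mul_eq_one.1 (hn x)
  refine ⟨⟨n, (IsLocallyConstant.iff_continuous n).2 ?_⟩, hn⟩
  refine Int.isClosedEmbedding_coe_real.isEmbedding.continuous_iff.2 ?_
  exact hf.congr fun x => (hn x).symm

/-! ## Bundle gerbes in terms of circle-valued functions

After a choice of a (discontinuous) multiplicative section of the bundle of a bundle gerbe, sections
of the bundle become circle-valued functions. -/

section Charts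

variable {E H Y M : Type*} [NormedAddCommGroup E] [NormedSpace ℝ E] [TopologicalSpace H]
  [TopologicalSpace Y] [ChartedSpace H Y]
  {E₁ H₁ X : Type*} [NormedAddCommGroup E₁] [NormedSpace ℝ E₁] [TopologicalSpace H₁]
  [TopologicalSpace X] [ChartedSpace H₁ X]
  {E₂ H₂ X' : Type*} [NormedAddCommGroup E₂] [NormedSpace ℝ E₂] [TopologicalSpace H₂]
  [TopologicalSpace X'] [ChartedSpace H₂ X']

/-- An atlas of circle-valued functions on the fibre product `Y ×_M Y` (as functions on `Y × Y`):
quotients are smooth on the fibre product, and `f(y₁,y₂) f'(y₂,y₃) / f''(y₁,y₃)` is smooth on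
the triple fibre product. -/
structure GerbeCharts (π : Y → M) (I : ModelWithCorners ℝ E H) where
  /-- open sets and functions on them -/
  atlas : Set (Set (Y × Y) × (Y × Y → Circle))
  isOpen : ∀ e ∈ atlas, IsOpen e.1
  cover : ∀ y₁ y₂, π y₁ = π y₂ → ∃ e ∈ atlas, (y₁, y₂) ∈ e.1
  smooth : ∀ e ∈ atlas, ∀ e' ∈ atlas, ContMDiffOn (I.prod I) (𝓡 1) ∞
    (fun y => e.2 y * (e'.2 y)⁻¹) {y | π y.1 = π y.2 ∧ y ∈ e.1 ∧ y ∈ e'.1}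
  mul : ∀ e ∈ atlas, ∀ e' ∈ atlas, ∀ e'' ∈ atlas, ContMDiffOn (I.prod (I.prod I)) (𝓡 1) ∞
    (fun y : Y × Y × Y => e.2 (y.1, y.2.1) * e'.2 (y.2.1, y.2.2) * (e''.2 (y.1, y.2.2))⁻¹)
    {y | (π y.1 = π y.2.1 ∧ π y.2.1 = π y.2.2) ∧
      (y.1, y.2.1) ∈ e.1 ∧ (y.2.1, y.2.2) ∈ e'.1 ∧ (y.1, y.2.2) ∈ e''.1}

variable {π : Y → M} {I : ModelWithCorners ℝ E H} {I₁ : ModelWithCorners ℝ E₁ H₁}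
  {I₂ : ModelWithCorners ℝ E₂ H₂}

/-- The maps `s`, `t` from `W` to `Y` are smooth at `x` and define a map to `Y ×_M Y`. -/
structure SmoothPairAt (π : Y → M) (I : ModelWithCorners ℝ E H) (I₁ : ModelWithCorners ℝ E₁ H₁)
    (W : Set X) (s t : X → Y) (x : X) : Prop where
  mem : x ∈ W
  left : ContMDiffWithinAt I₁ I ∞ s W x
  right : ContMDiffWithinAt I₁ I ∞ t W x
  eq : ∀ y ∈ W, π (s y) = π (t y)

namespace SmoothPairAt

variable {W : Set X} {s t u : X → Y} {x : X}

theorem symm (h : SmoothPairAt π I I₁ W s t x) : SmoothPairAt π I I₁ W t s x :=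
  ⟨h.mem, h.right, h.left, fun _ hy => (h.eq _ hy).symm⟩

theorem trans (h : SmoothPairAt π I I₁ W s t x) (h' : SmoothPairAt π I I₁ W t u x) :
    SmoothPairAt π I I₁ W s u x :=
  ⟨h.mem, h.left, h'.right, fun y hy => (h.eq y hy).trans (h'.eq y hy)⟩

theorem comp {W' : Set X'} {φ : X' → X} {x' : X'}
    (h : SmoothPairAt π I I₁ W s t (φ x')) (hx' : x' ∈ W') (hφ : ContMDiffWithinAt I₂ I₁ ∞ φ W' x')
    (hW : Set.MapsTo φ W' W) : SmoothPairAt π I I₂ W' (fun y => s (φ y)) (fun y => t (φ y)) x' :=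
  ⟨hx', h.left.comp x' hφ hW, h.right.comp x' hφ hW, fun _ hy => h.eq _ (hW hy)⟩

end SmoothPairAt

namespace GerbeCharts

variable (𝒜 : GerbeCharts π I)

/-- The function `f` on `W` is a smooth section over `(s, t) : W → Y ×_M Y` at the point `x`. -/
def SmoothAt (I₁ : ModelWithCorners ℝ E₁ H₁) (W : Set X) (s t : X → Y) (f : X → Circle) (x : X) :
    Prop :=
  ∀ e ∈ 𝒜.atlas, (s x, t x) ∈ e.1 →
    ContMDiffWithinAt I₁ (𝓡 1) ∞ (fun y => f y * (e.2 (s y, t y))⁻¹) W x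

variable {𝒜} {W : Set X} {s t u : X → Y} {f g : X → Circle} {x : X}

theorem contMDiffWithinAt_chart_div (h : SmoothPairAt π I I₁ W s t x) {e e'} (he : e ∈ 𝒜.atlas)
    (he' : e' ∈ 𝒜.atlas) (hx : (s x, t x) ∈ e.1) (hx' : (s x, t x) ∈ e'.1) :
    ContMDiffWithinAt I₁ (𝓡 1) ∞ (fun y => e.2 (s y, t y) * (e'.2 (s y, t y))⁻¹) W x := by
  have h1 : ContMDiffWithinAt I₁ (I.prod I) ∞ (fun y => (s y, t y)) W x :=
    h.left.prodMk h.right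
  refine (ContMDiffWithinAt.comp' x (𝒜.smooth e he e' he' (s x, t x) ⟨h.eq x h.mem, hx, hx'⟩)
    h1).mono_of_mem_nhdsWithin (Filter.inter_mem self_mem_nhdsWithin ?_)
  filter_upwards [self_mem_nhdsWithin, h1.continuousWithinAt ((𝒜.isOpen e he).mem_nhds hx),
    h1.continuousWithinAt ((𝒜.isOpen e' he').mem_nhds hx')] with y h2 h3 h4
  exact ⟨h.eq y h2, h3, h4⟩

theorem contMDiffWithinAt_chart_mul (h : SmoothPairAt π I I₁ W s t x)
    (h' : SmoothPairAt π I I₁ W t u x) {e e' e''} (he : e ∈ 𝒜.atlas)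
    (he' : e' ∈ 𝒜.atlas) (he'' : e'' ∈ 𝒜.atlas) (hx : (s x, t x) ∈ e.1) (hx' : (t x, u x) ∈ e'.1)
    (hx'' : (s x, u x) ∈ e''.1) :
    ContMDiffWithinAt I₁ (𝓡 1) ∞
      (fun y => e.2 (s y, t y) * e'.2 (t y, u y) * (e''.2 (s y, u y))⁻¹) W x := by
  have h1 : ContMDiffWithinAt I₁ (I.prod I) ∞ (fun y => (s y, t y)) W x :=
    h.left.prodMk h.right
  have h1' : ContMDiffWithinAt I₁ (I.prod I) ∞ (fun y => (t y, u y)) W x :=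
    h'.left.prodMk h'.right
  have h1'' : ContMDiffWithinAt I₁ (I.prod I) ∞ (fun y => (s y, u y)) W x :=
    h.left.prodMk h'.right
  have h2 : ContMDiffWithinAt I₁ (I.prod (I.prod I)) ∞ (fun y => (s y, t y, u y)) W x :=
    h.left.prodMk h1'
  refine (ContMDiffWithinAt.comp' x (𝒜.mul e he e' he' e'' he'' (s x, t x, u x)
    ⟨⟨h.eq x h.mem, h'.eq x h.mem⟩, hx, hx', hx''⟩) h2).mono_of_mem_nhdsWithin
      (Filter.inter_mem self_mem_nhdsWithin ?_)
  filter_upwards [self_mem_nhdsWithin, h1.continuousWithinAt ((𝒜.isOpen e he).mem_nhds hx),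
    h1'.continuousWithinAt ((𝒜.isOpen e' he').mem_nhds hx'),
    h1''.continuousWithinAt ((𝒜.isOpen e'' he'').mem_nhds hx'')] with y h3 h4 h5 h6
  exact ⟨⟨h.eq y h3, h'.eq y h3⟩, h4, h5, h6⟩

theorem exists_chart (𝒜 : GerbeCharts π I) (h : SmoothPairAt π I I₁ W s t x) :
    ∃ e ∈ 𝒜.atlas, (s x, t x) ∈ e.1 :=
  𝒜.cover _ _ (h.eq x h.mem)

theorem smoothAt_chart (h : SmoothPairAt π I I₁ W s t x) {e} (he : e ∈ 𝒜.atlas)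
    (hx : (s x, t x) ∈ e.1) : 𝒜.SmoothAt I₁ W s t (fun y => e.2 (s y, t y)) x :=
  fun _ he' hx' => contMDiffWithinAt_chart_div h he he' hx hx'

/-- Relative to a chart `e''` over `(s, u)`, the product is `(f/e) (g/e') (e e'/e'')`, and the last
factor is smooth by smoothness of the gerbe multiplication. -/
theorem SmoothAt.mul (h : SmoothPairAt π I I₁ W s t x) (h' : SmoothPairAt π I I₁ W t u x)
    (hf : 𝒜.SmoothAt I₁ W s t f x) (hg : 𝒜.SmoothAt I₁ W t u g x) :
    𝒜.SmoothAt I₁ W s u (fun y => f y * g y) x := by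
  obtain ⟨e, he, hx⟩ := 𝒜.exists_chart h
  obtain ⟨e', he', hx'⟩ := 𝒜.exists_chart h'
  intro e'' he'' hx''
  refine (((hf e he hx).mul (hg e' he' hx')).mul
    (contMDiffWithinAt_chart_mul h h' he he' he'' hx hx' hx'')).congr_of_mem (fun y _ => ?_) h.mem
  refine Additive.ofMul.injective ?_
  simp only [Pi.mul_apply, ofMul_mul, ofMul_inv]
  abel

theorem SmoothAt.contMDiff_mul (hx : x ∈ W) {z : X → Circle}
    (hz : ContMDiffWithinAt I₁ (𝓡 1) ∞ z W x) (hf : 𝒜.SmoothAt I₁ W s t f x) :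
    𝒜.SmoothAt I₁ W s t (fun y => z y * f y) x := fun e he hxe => by
  refine (hz.mul (hf e he hxe)).congr_of_mem (fun y _ => ?_) hx
  rw [Pi.mul_apply, mul_assoc]

theorem SmoothAt.div (h : SmoothPairAt π I I₁ W s t x)
    (hf : 𝒜.SmoothAt I₁ W s t f x) (hg : 𝒜.SmoothAt I₁ W s t g x) :
    ContMDiffWithinAt I₁ (𝓡 1) ∞ (fun y => f y * (g y)⁻¹) W x := by
  obtain ⟨e, he, hx⟩ := 𝒜.exists_chart h
  refine ((hf e he hx).mul (hg e he hx).inv).congr_of_mem (fun y _ => ?_) h.mem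
  refine Additive.ofMul.injective ?_
  simp only [Pi.mul_apply, ofMul_mul, ofMul_inv]
  abel

/-- Smoothness of inverses is not an axiom but follows from the multiplication. On the diagonal `e''
e''/e'' = e''`, so a chart over `(s, s)` is itself a smooth function (`h0`). Hence `e e'` is smooth
for charts over `(s, t)` and `(t, s)`, and `f⁻¹/e'` is the inverse of `(f/e) (e e')`. -/
theorem SmoothAt.inv (h : SmoothPairAt π I I₁ W s t x)
    (hf : 𝒜.SmoothAt I₁ W s t f x) : 𝒜.SmoothAt I₁ W t s (fun y => (f y)⁻¹) x := by
  obtain ⟨e, he, hx⟩ := 𝒜.exists_chart h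
  obtain ⟨e'', he'', hx''⟩ := 𝒜.exists_chart (h.trans h.symm)
  have h0 := contMDiffWithinAt_chart_mul (h.trans h.symm) (h.trans h.symm) he'' he'' he''
    hx'' hx'' hx''
  intro e' he' hx'
  have h1 := contMDiffWithinAt_chart_mul h h.symm he he' he'' hx hx' hx''
  refine (((hf e he hx).mul h1).mul h0).inv.congr_of_mem (fun y _ => ?_) h.mem
  refine Additive.ofMul.injective ?_
  simp only [Pi.mul_apply, ofMul_mul, ofMul_inv]
  abel

theorem SmoothAt.congr (hx : x ∈ W) (hf : 𝒜.SmoothAt I₁ W s t f x) (hfg : ∀ y ∈ W, g y = f y) :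
    𝒜.SmoothAt I₁ W s t g x := fun e he hxe =>
  (hf e he hxe).congr_of_mem (fun y hy => by rw [hfg y hy]) hx

theorem SmoothAt.comp {W' : Set X'} {φ : X' → X} {x' : X'}
    (hf : 𝒜.SmoothAt I₁ W s t f (φ x')) (hφ : ContMDiffWithinAt I₂ I₁ ∞ φ W' x')
    (hW : Set.MapsTo φ W' W) :
    𝒜.SmoothAt I₂ W' (fun y => s (φ y)) (fun y => t (φ y)) (fun y => f (φ y)) x' :=
  fun e he hxe => (hf e he hxe).comp x' hφ hW

theorem SmoothAt.mono {W' : Set X} (hf : 𝒜.SmoothAt I₁ W s t f x) (hW : W' ⊆ W) :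
    𝒜.SmoothAt I₁ W' s t f x := fun e he hxe => (hf e he hxe).mono hW

end GerbeCharts

end Charts

/-! ## Dixmier–Douady cocycles -/

section Cocycles

variable {M : Type*} [TopologicalSpace M]

theorem PointedCover.d_two_apply {𝒰 : PointedCover M} (c : 𝒰.Cochain 2) (i : Fin 4 → M)
    (x : 𝒰.inter i) : 𝒰.d 2 c i x =
      c (i ∘ (0 : Fin 4).succAbove) (𝒰.faceIncl i 0 x) -
      c (i ∘ (1 : Fin 4).succAbove) (𝒰.faceIncl i 1 x) +
      c (i ∘ (2 : Fin 4).succAbove) (𝒰.faceIncl i 2 x) -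
      c (i ∘ (3 : Fin 4).succAbove) (𝒰.faceIncl i 3 x) := by
  rw [PointedCover.d_apply, Fin.sum_univ_four]
  simp
  ring

theorem PointedCover.d_three_apply {𝒰 : PointedCover M} (c : 𝒰.Cochain 3) (i : Fin 5 → M)
    (x : 𝒰.inter i) : 𝒰.d 3 c i x =
      c (i ∘ (0 : Fin 5).succAbove) (𝒰.faceIncl i 0 x) -
      c (i ∘ (1 : Fin 5).succAbove) (𝒰.faceIncl i 1 x) +
      c (i ∘ (2 : Fin 5).succAbove) (𝒰.faceIncl i 2 x) -
      c (i ∘ (3 : Fin 5).succAbove) (𝒰.faceIncl i 3 x) +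
      c (i ∘ (4 : Fin 5).succAbove) (𝒰.faceIncl i 4 x) := by
  rw [PointedCover.d_apply, Fin.sum_univ_five]
  have h3 : (((3 : Fin 5) : Fin 5) : ℕ) = 3 := rfl
  have h4 : (((4 : Fin 5) : Fin 5) : ℕ) = 4 := rfl
  rw [h3, h4]
  simp
  ring

end Cocycles

/-! ### Existence of the choices that define the class -/

section DD

variable {E H Y F K M : Type*} [NormedAddCommGroup E] [NormedSpace ℝ E] [TopologicalSpace H]
  [TopologicalSpace Y] [ChartedSpace H Y]
  [NormedAddCommGroup F] [NormedSpace ℝ F] [TopologicalSpace K]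
  [TopologicalSpace M] [ChartedSpace K M]
  {π : Y → M} {I : ModelWithCorners ℝ E H} {J : ModelWithCorners ℝ F K}

namespace LocalSections

/-- The restriction of local sections to a refinement of the cover. -/
def restrict (L : LocalSections π I J) (𝒱 : PointedCover M) (k : M → M)
    (h : ∀ x, 𝒱.U x ⊆ L.cover.U (k x)) : LocalSections π I J where
  cover := 𝒱
  s a := L.s (k a)
  smooth a := (L.smooth (k a)).mono (h a)
  proj a x hx := L.proj (k a) x (h a hx)

variable (L : LocalSections π I J)

theorem isOpen_overlap (a b : M) : IsOpen (L.overlap a b) :=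
  (L.cover.isOpen a).inter (L.cover.isOpen b)

theorem smoothPairAt {W : Set M} {a b x : M} (hW : W ⊆ L.overlap a b) (hx : x ∈ W) :
    SmoothPairAt π I J W (L.s a) (L.s b) x :=
  ⟨hx, (L.smooth a x (hW hx).1).mono fun _ hy => (hW hy).1,
    (L.smooth b x (hW hx).2).mono fun _ hy => (hW hy).2,
    fun _ hy => L.fiber_eq (hW hy).1 (hW hy).2⟩

end LocalSections

theorem exists_localSections [I.Boundaryless] (hsurj : Function.Surjective π)
    (hsub : Manifold.IsSubmersion I J ∞ π) : Nonempty (LocalSections π I J) := by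
  have h : ∀ x : M, ∃ (V : Set M) (s : M → Y), IsOpen V ∧ x ∈ V ∧ ContMDiffOn J I ∞ s V ∧
      ∀ y ∈ V, π (s y) = y := by
    intro x
    obtain ⟨p, rfl⟩ := hsurj x
    exact exists_localSection (hsub.isSubmersionAt p)
  choose V s hV hx hs hp using h
  exact ⟨⟨⟨V, hV, hx⟩, s, hs, hp⟩⟩

/-- The choices in the definition of the Dixmier–Douady class. -/
structure DDData (𝒜 : GerbeCharts π I) (J : ModelWithCorners ℝ F K) where
  /-- the cover and the sections of `π` -/
  L : LocalSections π I J
  /-- the sections over the overlaps -/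
  τ : M → M → M → Circle
  smooth_τ : ∀ a b, ∀ x ∈ L.overlap a b,
    𝒜.SmoothAt J (L.overlap a b) (L.s a) (L.s b) (τ a b) x
  /-- logarithms of the circle-valued cocycle -/
  w : M → M → M → M → ℝ
  smooth_w : ∀ a b c, ContMDiffOn J 𝓘(ℝ, ℝ) ∞ (w a b c)
    (L.cover.U a ∩ L.cover.U b ∩ L.cover.U c)
  exp_w : ∀ a b c, ∀ x ∈ L.cover.U a ∩ L.cover.U b ∩ L.cover.U c,
    Circle.exp (2 * Real.pi * w a b c x) = τ a b x * τ b c x * (τ a c x)⁻¹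

/-- The integer cocycle of the choices. -/
def DDData.HasCocycle {𝒜 : GerbeCharts π I} (D : DDData 𝒜 J) (n : D.L.cover.Cochain 3) : Prop :=
  ∀ (i : Fin 4 → M) (x : D.L.cover.inter i),
    ((n i x : ℤ) : ℝ) = D.w (i 1) (i 2) (i 3) x - D.w (i 0) (i 2) (i 3) x
        + D.w (i 0) (i 1) (i 3) x - D.w (i 0) (i 1) (i 2) x

variable {𝒜 : GerbeCharts π I}

/-- In `ℝ` the cochain is the formal coboundary of `w`, and the square of the coboundary vanishes.
The identity is checked after the injection of `ℤ` into `ℝ`. -/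
theorem DDData.HasCocycle.mem_cocycles {D : DDData 𝒜 J} {n : D.L.cover.Cochain 3}
    (hn : D.HasCocycle n) : n ∈ D.L.cover.cocycles 3 := by
  rw [AddMonoidHom.mem_ker]
  funext i
  ext x
  rw [PointedCover.d_three_apply]
  have h0 := hn (i ∘ (0 : Fin 5).succAbove) (D.L.cover.faceIncl i 0 x)
  have h1 := hn (i ∘ (1 : Fin 5).succAbove) (D.L.cover.faceIncl i 1 x)
  have h2 := hn (i ∘ (2 : Fin 5).succAbove) (D.L.cover.faceIncl i 2 x)
  have h3 := hn (i ∘ (3 : Fin 5).succAbove) (D.L.cover.faceIncl i 3 x)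
  have h4 := hn (i ∘ (4 : Fin 5).succAbove) (D.L.cover.faceIncl i 4 x)
  refine Int.cast_injective (α := ℝ) ?_
  push_cast
  rw [h0, h1, h2, h3, h4]
  change D.w (i 2) (i 3) (i 4) x - D.w (i 1) (i 3) (i 4) x
      + D.w (i 1) (i 2) (i 4) x - D.w (i 1) (i 2) (i 3) x
    - (D.w (i 2) (i 3) (i 4) x - D.w (i 0) (i 3) (i 4) x
      + D.w (i 0) (i 2) (i 4) x - D.w (i 0) (i 2) (i 3) x)
    + (D.w (i 1) (i 3) (i 4) x - D.w (i 0) (i 3) (i 4) x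
      + D.w (i 0) (i 1) (i 4) x - D.w (i 0) (i 1) (i 3) x)
    - (D.w (i 1) (i 2) (i 4) x - D.w (i 0) (i 2) (i 4) x
      + D.w (i 0) (i 1) (i 4) x - D.w (i 0) (i 1) (i 2) x)
    + (D.w (i 1) (i 2) (i 3) x - D.w (i 0) (i 2) (i 3) x
      + D.w (i 0) (i 1) (i 3) x - D.w (i 0) (i 1) (i 2) x) = ((0 : ℤ) : ℝ)
  push_cast
  ring

/-- The exponential of `w` is the formal coboundary of `τ`, so the coboundary of `w` has exponential
`1`. It is therefore integer-valued, and by continuity locally constant. -/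
theorem DDData.exists_hasCocycle (D : DDData 𝒜 J) : ∃ n, D.HasCocycle n := by
  have hc : ∀ (i : Fin 4 → M) (a b c : Fin 4),
      Continuous fun x : D.L.cover.inter i => D.w (i a) (i b) (i c) x := fun i a b c =>
    ((D.smooth_w (i a) (i b) (i c)).continuousOn.mono fun _ (hx : _ ∈ D.L.cover.inter i) =>
      ⟨⟨hx a, hx b⟩, hx c⟩).domRestrict
  have := fun i : Fin 4 → M => exists_locallyConstant (fun x : D.L.cover.inter i =>
    D.w (i 1) (i 2) (i 3) x - D.w (i 0) (i 2) (i 3) x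
        + D.w (i 0) (i 1) (i 3) x - D.w (i 0) (i 1) (i 2) x)
    ((((hc i 1 2 3).sub (hc i 0 2 3)).add (hc i 0 1 3)).sub (hc i 0 1 2)) fun x => by
      simp only [mul_sub, mul_add, Circle.exp_add, Circle.exp_sub]
      rw [D.exp_w _ _ _ _ ⟨⟨x.2 1, x.2 2⟩, x.2 3⟩, D.exp_w _ _ _ _ ⟨⟨x.2 0, x.2 2⟩, x.2 3⟩,
        D.exp_w _ _ _ _ ⟨⟨x.2 0, x.2 1⟩, x.2 3⟩, D.exp_w _ _ _ _ ⟨⟨x.2 0, x.2 1⟩, x.2 2⟩]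
      refine Additive.ofMul.injective ?_
      simp only [ofMul_mul, ofMul_inv, ofMul_div, ofMul_one]
      abel
  choose n hn using this
  exact ⟨n, hn⟩

/-- The class `c` is computed from some choices. -/
def GerbeCharts.IsDDClass (𝒜 : GerbeCharts π I) (J : ModelWithCorners ℝ F K) (c : CechH M 3) :
    Prop :=
  ∃ (D : DDData 𝒜 J) (n : D.L.cover.cocycles 3), D.HasCocycle n.1 ∧ c = cechClass D.L.cover 3 n

variable [T2Space M] [ParacompactSpace M]

/-- A chart found near one point of an overlap need not be defined on all of it. After refinement,
the chart chosen at the point `a` is defined on all of `𝒱.U a` for each `b` with `𝒱.U b` meeting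
`𝒱.U a`, and so serves as the section over the whole overlap. -/
theorem exists_sections (𝒜 : GerbeCharts π I) (L : LocalSections π I J) :
    ∃ (L' : LocalSections π I J) (τ : M → M → M → Circle), ∀ a b, ∀ x ∈ L'.overlap a b,
      𝒜.SmoothAt J (L'.overlap a b) (L'.s a) (L'.s b) (τ a b) x := by
  have h : ∀ x a b, ∃ e : Set (Y × Y) × (Y × Y → Circle), x ∈ L.overlap a b →
      e ∈ 𝒜.atlas ∧ (L.s a x, L.s b x) ∈ e.1 := by
    intro x a b
    by_cases hx : x ∈ L.overlap a b
    · obtain ⟨e, he, hxe⟩ := 𝒜.exists_chart (L.smoothPairAt subset_rfl hx)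
      exact ⟨e, fun _ => ⟨he, hxe⟩⟩
    · exact ⟨⟨∅, fun _ => 1⟩, fun h => (hx h).elim⟩
  choose e he using h
  obtain ⟨𝒱, k, -, hk, hN⟩ := L.cover.exists_refinement
    (fun x a b _ => L.overlap a b ∩ (fun y => (L.s a y, L.s b y)) ⁻¹' (e x a b).1) (by
      intro x a b _ ha hb _
      obtain ⟨he, hxe⟩ := he x a b ⟨ha, hb⟩
      have hc : ContinuousOn (fun y => (L.s a y, L.s b y)) (L.overlap a b) :=
        ((L.smooth a).continuousOn.mono Set.inter_subset_left).prodMk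
          ((L.smooth b).continuousOn.mono Set.inter_subset_right)
      exact (hc.isOpen_inter_preimage (L.isOpen_overlap a b) (𝒜.isOpen _ he)).mem_nhds
        ⟨⟨ha, hb⟩, hxe⟩)
  refine ⟨L.restrict 𝒱 k hk, fun a b y => (e a (k a) (k b)).2 (L.s (k a) y, L.s (k b) y), ?_⟩
  rintro a b x ⟨hxa, hxb⟩
  have hne : (𝒱.U a ∩ 𝒱.U b).Nonempty := ⟨x, hxa, hxb⟩
  have hsub := hN a b b hne hne
  -- The cover is pointed: `a ∈ 𝒱.U a` puts `a` itself in the old overlap, so the choice made at `a`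
  -- is a genuine chart.
  obtain ⟨h1, -⟩ := he a (k a) (k b) (hsub (𝒱.mem a)).1
  exact GerbeCharts.smoothAt_chart ((L.restrict 𝒱 k hk).smoothPairAt subset_rfl ⟨hxa, hxb⟩) h1
    (hsub hxa).2

/-- A second refinement, now indexed by triples, turns local logarithms of `τ_ab τ_bc / τ_ac` into
logarithms on whole triple overlaps. -/
theorem exists_ddData (𝒜 : GerbeCharts π I) (L₀ : LocalSections π I J) :
    Nonempty (DDData 𝒜 J) := by
  obtain ⟨L, τ, hτ⟩ := exists_sections 𝒜 L₀
  have h : ∀ x a b c, ∃ (N : Set M) (w : M → ℝ),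
      x ∈ L.cover.U a ∩ L.cover.U b ∩ L.cover.U c → N ∈ 𝓝 x ∧ ContMDiffOn J 𝓘(ℝ, ℝ) ∞ w N ∧
      ∀ y ∈ N, Circle.exp (2 * Real.pi * w y) = τ a b y * τ b c y * (τ a c y)⁻¹ := by
    intro x a b c
    by_cases hx : x ∈ L.cover.U a ∩ L.cover.U b ∩ L.cover.U c
    · obtain ⟨N, w, h⟩ := exists_local_log (J := J)
        (((L.cover.isOpen a).inter (L.cover.isOpen b)).inter (L.cover.isOpen c))
        (g := fun y => τ a b y * τ b c y * (τ a c y)⁻¹) (by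
          intro y hy
          have hab : L.cover.U a ∩ L.cover.U b ∩ L.cover.U c ⊆ L.overlap a b :=
            fun z hz => hz.1
          have hbc : L.cover.U a ∩ L.cover.U b ∩ L.cover.U c ⊆ L.overlap b c :=
            fun z hz => ⟨hz.1.2, hz.2⟩
          have hac : L.cover.U a ∩ L.cover.U b ∩ L.cover.U c ⊆ L.overlap a c :=
            fun z hz => ⟨hz.1.1, hz.2⟩
          exact GerbeCharts.SmoothAt.div (L.smoothPairAt hac hy)
            (((hτ a b y (hab hy)).mono hab).mul (L.smoothPairAt hab hy) (L.smoothPairAt hbc hy)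
              ((hτ b c y (hbc hy)).mono hbc)) ((hτ a c y (hac hy)).mono hac)) hx
      exact ⟨N, w, fun _ => h⟩
    · exact ⟨∅, fun _ => 0, fun h => (hx h).elim⟩
  choose N w hw using h
  obtain ⟨𝒱, k, -, hk, hN⟩ := L.cover.exists_refinement
    (fun x a b c => N x a b c ∩ (L.cover.U a ∩ L.cover.U b ∩ L.cover.U c))
    fun x a b c ha hb hc => Filter.inter_mem (hw x a b c ⟨⟨ha, hb⟩, hc⟩).1
      ((((L.cover.isOpen a).inter (L.cover.isOpen b)).inter (L.cover.isOpen c)).mem_nhds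
        ⟨⟨ha, hb⟩, hc⟩)
  have key : ∀ a b c, ∀ x ∈ 𝒱.U a ∩ 𝒱.U b ∩ 𝒱.U c,
      x ∈ N a (k a) (k b) (k c) ∧ a ∈ L.cover.U (k a) ∩ L.cover.U (k b) ∩ L.cover.U (k c) := by
    rintro a b c x ⟨⟨ha, hb⟩, hc⟩
    have hsub := hN a b c ⟨x, ha, hb⟩ ⟨x, ha, hc⟩
    exact ⟨(hsub ha).1, (hsub (𝒱.mem a)).2⟩
  refine ⟨⟨L.restrict 𝒱 k hk, fun a b => τ (k a) (k b), fun a b x hx => ?_,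
    fun a b c => w a (k a) (k b) (k c), fun a b c => ?_, fun a b c x hx => ?_⟩⟩
  · exact (hτ (k a) (k b) x ⟨hk a hx.1, hk b hx.2⟩).mono (Set.inter_subset_inter (hk a) (hk b))
  · intro x hx
    obtain ⟨-, h2⟩ := key a b c x hx
    exact ((hw _ _ _ _ h2).2.1.mono fun y hy => (key a b c y hy).1) x hx
  · obtain ⟨h1, h2⟩ := key a b c x hx
    exact (hw _ _ _ _ h2).2.2 x h1

end DD

/-! ## Uniqueness of the Dixmier–Douady class -/

section Classes

variable {M : Type*} [TopologicalSpace M]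

theorem cechClass_eq_res {𝒰 𝒱 : PointedCover M} (h : 𝒰 ≤ 𝒱) (k : ℕ) (c : 𝒰.cocycles k) :
    cechClass 𝒰 k c = cechClass 𝒱 k (PointedCover.resCocycles h k c) :=
  DirectLimit.eq_of_le _ 𝒱 h

theorem cechClass_eq_of_res_sub {𝒰 𝒰' 𝒱 : PointedCover M} (h : 𝒰 ≤ 𝒱) (h' : 𝒰' ≤ 𝒱) {k : ℕ}
    (c : 𝒰.cocycles (k + 1)) (c' : 𝒰'.cocycles (k + 1)) (b : 𝒱.Cochain k)
    (hb : PointedCover.res h' (k + 1) c'.1 - PointedCover.res h (k + 1) c.1 = 𝒱.d k b) :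
    cechClass 𝒰 (k + 1) c = cechClass 𝒰' (k + 1) c' := by
  rw [cechClass_eq_res h, cechClass_eq_res h']
  have : (QuotientAddGroup.mk (PointedCover.resCocycles h (k + 1) c) : 𝒱.H (k + 1)) =
      QuotientAddGroup.mk (PointedCover.resCocycles h' (k + 1) c') := by
    refine QuotientAddGroup.eq.2 ?_
    change -(PointedCover.res h (k + 1) c.1) + PointedCover.res h' (k + 1) c'.1 ∈
      𝒱.coboundaries (k + 1)
    rw [neg_add_eq_sub, hb]
    exact ⟨b, rfl⟩
  unfold cechClass
  rw [this]

theorem exists_eq_d_of_cechClass_eq_zero {𝒰 : PointedCover M} {k : ℕ} (c : 𝒰.cocycles (k + 1))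
    (hc : cechClass 𝒰 (k + 1) c = 0) :
    ∃ (𝒱 : PointedCover M) (h : 𝒰 ≤ 𝒱) (b : 𝒱.Cochain k),
      PointedCover.res h (k + 1) c.1 = 𝒱.d k b := by
  rw [DirectLimit.zero_def 𝒰] at hc
  obtain ⟨𝒱, h, h', heq⟩ := Quotient.exact hc
  have h0 : PointedCover.resH (k + 1) 𝒰 𝒱 h' 0 = 0 := map_zero _
  have h1 : (QuotientAddGroup.mk (PointedCover.resCocycles h (k + 1) c) : 𝒱.H (k + 1)) = 0 :=
    heq.trans h0
  rw [QuotientAddGroup.eq_zero_iff] at h1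
  obtain ⟨b, hb⟩ := (show PointedCover.res h (k + 1) c.1 ∈ 𝒱.coboundaries (k + 1) from h1)
  exact ⟨𝒱, h, b, hb.symm⟩

end Classes

section Unique

variable {E H Y F K M : Type*} [NormedAddCommGroup E] [NormedSpace ℝ E] [TopologicalSpace H]
  [TopologicalSpace Y] [ChartedSpace H Y]
  [NormedAddCommGroup F] [NormedSpace ℝ F] [TopologicalSpace K]
  [TopologicalSpace M] [ChartedSpace K M]
  {π : Y → M} {I : ModelWithCorners ℝ E H} {J : ModelWithCorners ℝ F K}
  {𝒜 : GerbeCharts π I} [T2Space M] [ParacompactSpace M]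

/-- Over the members of some cover the local sections of `D` and `D'` are compared by functions
`ρ`, in such a way that the quotients of the sections over overlaps have logarithms. -/
theorem DDData.exists_comparison (D D' : DDData 𝒜 J) :
    ∃ (𝒱 : PointedCover M) (_ : D.L.cover ≤ 𝒱) (_ : D'.L.cover ≤ 𝒱)
      (ρ : M → M → Circle) (l : M → M → M → ℝ),
      (∀ a b, ContinuousOn (l a b) (𝒱.U a ∩ 𝒱.U b)) ∧
      ∀ a b, ∀ x ∈ 𝒱.U a ∩ 𝒱.U b, Circle.exp (2 * Real.pi * l a b x) =
        ρ a x * D'.τ a b x * (D.τ a b x)⁻¹ * (ρ b x)⁻¹ := by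
  have h : ∀ a, ∃ e ∈ 𝒜.atlas, (D.L.s a a, D'.L.s a a) ∈ e.1 := fun a =>
    𝒜.cover _ _ ((D.L.proj a a (D.L.cover.mem a)).trans (D'.L.proj a a (D'.L.cover.mem a)).symm)
  choose e he hea using h
  let T : M → Set M := fun a => D.L.cover.U a ∩ D'.L.cover.U a
  have hT : ∀ a, IsOpen (T a) := fun a => (D.L.cover.isOpen a).inter (D'.L.cover.isOpen a)
  let 𝒰 : PointedCover M :=
    { U := fun a => T a ∩ (fun x => (D.L.s a x, D'.L.s a x)) ⁻¹' (e a).1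
      isOpen := fun a => by
        have hc : ContinuousOn (fun x => (D.L.s a x, D'.L.s a x)) (T a) :=
          ((D.L.smooth a).continuousOn.mono Set.inter_subset_left).prodMk
            ((D'.L.smooth a).continuousOn.mono Set.inter_subset_right)
        exact hc.isOpen_inter_preimage (hT a) (𝒜.isOpen _ (he a))
      mem := fun a => ⟨⟨D.L.cover.mem a, D'.L.cover.mem a⟩, hea a⟩ }
  have hU : ∀ a, 𝒰.U a ⊆ D.L.cover.U a := fun a x hx => hx.1.1
  have hU' : ∀ a, 𝒰.U a ⊆ D'.L.cover.U a := fun a x hx => hx.1.2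
  -- A smooth local section of `P` over the pair `(s_a, s'_a)` formed by the two sections of `π`.
  let ρ : M → M → Circle := fun a x => (e a).2 (D.L.s a x, D'.L.s a x)
  have hpair : ∀ (a : M) (W : Set M), W ⊆ 𝒰.U a → ∀ x ∈ W,
      SmoothPairAt π I J W (D.L.s a) (D'.L.s a) x := fun a W hW x hx =>
    ⟨hx, (D.L.smooth a x (hU a (hW hx))).mono fun _ hy => hU a (hW hy),
      (D'.L.smooth a x (hU' a (hW hx))).mono fun _ hy => hU' a (hW hy),
      fun y hy => (D.L.proj a y (hU a (hW hy))).trans (D'.L.proj a y (hU' a (hW hy))).symm⟩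
  have hρ : ∀ (a : M) (W : Set M), W ⊆ 𝒰.U a → ∀ x ∈ W,
      𝒜.SmoothAt J W (D.L.s a) (D'.L.s a) (ρ a) x := fun a W hW x hx =>
    GerbeCharts.smoothAt_chart (hpair a W hW x hx) (he a) (hW hx).2
  have hlog : ∀ x a b, ∃ (N : Set M) (l : M → ℝ), x ∈ 𝒰.U a ∩ 𝒰.U b →
      N ∈ 𝓝 x ∧ ContMDiffOn J 𝓘(ℝ, ℝ) ∞ l N ∧ ∀ y ∈ N, Circle.exp (2 * Real.pi * l y) =
        ρ a y * D'.τ a b y * (D.τ a b y * ρ b y)⁻¹ := by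
    intro x a b
    by_cases hx : x ∈ 𝒰.U a ∩ 𝒰.U b
    · have ha : 𝒰.U a ∩ 𝒰.U b ⊆ 𝒰.U a := Set.inter_subset_left
      have hb : 𝒰.U a ∩ 𝒰.U b ⊆ 𝒰.U b := Set.inter_subset_right
      have hD : 𝒰.U a ∩ 𝒰.U b ⊆ D.L.overlap a b := Set.inter_subset_inter (hU a) (hU b)
      have hD' : 𝒰.U a ∩ 𝒰.U b ⊆ D'.L.overlap a b := Set.inter_subset_inter (hU' a) (hU' b)
      obtain ⟨N, l, h⟩ := exists_local_log (J := J) ((𝒰.isOpen a).inter (𝒰.isOpen b))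
        (g := fun y => ρ a y * D'.τ a b y * (D.τ a b y * ρ b y)⁻¹) (by
          intro y hy
          have p1 := hpair a _ ha y hy
          have p2 := hpair b _ hb y hy
          have p3 := D.L.smoothPairAt hD hy
          have p4 := D'.L.smoothPairAt hD' hy
          exact GerbeCharts.SmoothAt.div (p1.trans p4)
            ((hρ a _ ha y hy).mul p1 p4 ((D'.smooth_τ a b y (hD' hy)).mono hD'))
            (((D.smooth_τ a b y (hD hy)).mono hD).mul p3 p2 (hρ b _ hb y hy))) hx
      exact ⟨N, l, fun _ => h⟩
    · exact ⟨∅, fun _ => 0, fun h => (hx h).elim⟩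
  choose N l hl using hlog
  obtain ⟨𝒱, k, h𝒱, hk, hN⟩ := 𝒰.exists_refinement
    (fun x a b _ => N x a b ∩ (𝒰.U a ∩ 𝒰.U b))
    fun x a b c ha hb hc => Filter.inter_mem (hl x a b ⟨ha, hb⟩).1
      (((𝒰.isOpen a).inter (𝒰.isOpen b)).mem_nhds ⟨ha, hb⟩)
  have key : ∀ a b, ∀ x ∈ 𝒱.U a ∩ 𝒱.U b, x ∈ N a (k a) (k b) ∧ a ∈ 𝒰.U (k a) ∩ 𝒰.U (k b) := by
    rintro a b x ⟨ha, hb⟩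
    have hsub := hN a b b ⟨x, ha, hb⟩ ⟨x, ha, hb⟩
    exact ⟨(hsub ha).1, (hsub (𝒱.mem a)).2⟩
  have c1 : ∀ a b, ∀ x ∈ 𝒱.U a ∩ 𝒱.U b, x ∈ 𝒰.U (k a) ∩ 𝒰.U a ∩ 𝒰.U b := fun a b x hx =>
    ⟨⟨hk a hx.1, h𝒱 a hx.1⟩, h𝒱 b hx.2⟩
  have c2 : ∀ a b, ∀ x ∈ 𝒱.U a ∩ 𝒱.U b, x ∈ 𝒰.U (k a) ∩ 𝒰.U (k b) ∩ 𝒰.U b := fun a b x hx =>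
    ⟨⟨hk a hx.1, hk b hx.2⟩, h𝒱 b hx.2⟩
  have i1 : ∀ a b c, 𝒰.U a ∩ 𝒰.U b ∩ 𝒰.U c ⊆
      D.L.cover.U a ∩ D.L.cover.U b ∩ D.L.cover.U c := fun a b c =>
    Set.inter_subset_inter (Set.inter_subset_inter (hU a) (hU b)) (hU c)
  have i2 : ∀ a b c, 𝒰.U a ∩ 𝒰.U b ∩ 𝒰.U c ⊆
      D'.L.cover.U a ∩ D'.L.cover.U b ∩ D'.L.cover.U c := fun a b c =>
    Set.inter_subset_inter (Set.inter_subset_inter (hU' a) (hU' b)) (hU' c)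
  -- The logarithms belong to the indices `k a`, `k b`, whereas cochains restrict to `𝒱` with
  -- unchanged indices. Transporting `ρ` from `k a` to `a` by `τ'_(k a, a) / τ_(k a, a)` repairs
  -- this, and the `w` terms are logarithms of the resulting corrections: `w_(k a, a, b) - w_(k a, k
  -- b, b)` exponentiates to `τ_(k a, a) τ_ab / (τ_(k a, k b) τ_(k b, b))`.
  refine ⟨𝒱, fun a => (h𝒱 a).trans (hU a), fun a => (h𝒱 a).trans (hU' a),
    fun a x => ρ (k a) x * D'.τ (k a) a x * (D.τ (k a) a x)⁻¹,
    fun a b x => l a (k a) (k b) x + (D'.w (k a) a b x - D'.w (k a) (k b) b x) -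
      (D.w (k a) a b x - D.w (k a) (k b) b x), ?_, ?_⟩
  · intro a b x hx
    have hlc : ContinuousWithinAt (l a (k a) (k b)) (𝒱.U a ∩ 𝒱.U b) x :=
      ((hl _ _ _ (key a b x hx).2).2.1.continuousOn x (key a b x hx).1).mono
        fun y hy => (key a b y hy).1
    exact (hlc.add ((((D'.smooth_w _ _ _).continuousOn x (i2 _ _ _ (c1 a b x hx))).mono
        fun y hy => i2 _ _ _ (c1 a b y hy)).sub
      (((D'.smooth_w _ _ _).continuousOn x (i2 _ _ _ (c2 a b x hx))).mono
        fun y hy => i2 _ _ _ (c2 a b y hy)))).sub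
      ((((D.smooth_w _ _ _).continuousOn x (i1 _ _ _ (c1 a b x hx))).mono
        fun y hy => i1 _ _ _ (c1 a b y hy)).sub
      (((D.smooth_w _ _ _).continuousOn x (i1 _ _ _ (c2 a b x hx))).mono
        fun y hy => i1 _ _ _ (c2 a b y hy)))
  · intro a b x hx
    simp only [mul_sub, mul_add, Circle.exp_add, Circle.exp_sub]
    rw [(hl _ _ _ (key a b x hx).2).2.2 x (key a b x hx).1,
      D.exp_w _ _ _ _ (i1 _ _ _ (c1 a b x hx)), D.exp_w _ _ _ _ (i1 _ _ _ (c2 a b x hx)),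
      D'.exp_w _ _ _ _ (i2 _ _ _ (c1 a b x hx)), D'.exp_w _ _ _ _ (i2 _ _ _ (c2 a b x hx))]
    refine Additive.ofMul.injective ?_
    simp only [ofMul_mul, ofMul_inv, ofMul_div]
    abel

/-- In the coboundary of the comparison `l` the factors `ρ` cancel, so `δl` and `w' - w` have the
same exponential. Their difference `b` is an integer cochain, and `δb = n' - n` because `δδl = 0`.
-/
theorem DDData.cechClass_eq (D D' : DDData 𝒜 J) (n : D.L.cover.cocycles 3)
    (n' : D'.L.cover.cocycles 3) (hn : D.HasCocycle n.1) (hn' : D'.HasCocycle n'.1) :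
    cechClass D.L.cover 3 n = cechClass D'.L.cover 3 n' := by
  obtain ⟨𝒱, h, h', ρ, l, hlc, hl⟩ := D.exists_comparison D'
  have hw : ∀ (D : DDData 𝒜 J), D.L.cover ≤ 𝒱 → ∀ i : Fin 3 → M,
      Continuous fun x : 𝒱.inter i => D.w (i 0) (i 1) (i 2) x := fun D h i =>
    ((D.smooth_w (i 0) (i 1) (i 2)).continuousOn.mono fun _ (hx : _ ∈ 𝒱.inter i) =>
      ⟨⟨h _ (hx 0), h _ (hx 1)⟩, h _ (hx 2)⟩).domRestrict
  have hlc' : ∀ (i : Fin 3 → M) (a b : Fin 3),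
      Continuous fun x : 𝒱.inter i => l (i a) (i b) x := fun i a b =>
    ((hlc (i a) (i b)).mono fun _ (hx : _ ∈ 𝒱.inter i) => ⟨hx a, hx b⟩).domRestrict
  have hb := fun i : Fin 3 → M => exists_locallyConstant (fun x : 𝒱.inter i =>
    D'.w (i 0) (i 1) (i 2) x - D.w (i 0) (i 1) (i 2) x -
      (l (i 0) (i 1) x + l (i 1) (i 2) x - l (i 0) (i 2) x))
    (((hw D' h' i).sub (hw D h i)).sub (((hlc' i 0 1).add (hlc' i 1 2)).sub (hlc' i 0 2)))
    fun x => by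
      simp only [mul_sub, mul_add, Circle.exp_add, Circle.exp_sub]
      rw [D.exp_w _ _ _ _ ⟨⟨h _ (x.2 0), h _ (x.2 1)⟩, h _ (x.2 2)⟩,
        D'.exp_w _ _ _ _ ⟨⟨h' _ (x.2 0), h' _ (x.2 1)⟩, h' _ (x.2 2)⟩,
        hl _ _ _ ⟨x.2 0, x.2 1⟩, hl _ _ _ ⟨x.2 1, x.2 2⟩, hl _ _ _ ⟨x.2 0, x.2 2⟩]
      refine Additive.ofMul.injective ?_
      simp only [ofMul_mul, ofMul_inv, ofMul_div, ofMul_one]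
      abel
  choose b hb using hb
  refine cechClass_eq_of_res_sub h h' n n' b ?_
  funext i
  ext x
  have h0 := hb (i ∘ (0 : Fin 4).succAbove) (𝒱.faceIncl i 0 x)
  have h1 := hb (i ∘ (1 : Fin 4).succAbove) (𝒱.faceIncl i 1 x)
  have h2 := hb (i ∘ (2 : Fin 4).succAbove) (𝒱.faceIncl i 2 x)
  have h3 := hb (i ∘ (3 : Fin 4).succAbove) (𝒱.faceIncl i 3 x)
  have e1 := hn i (PointedCover.refineIncl h i x)
  have e2 := hn' i (PointedCover.refineIncl h' i x)
  rw [PointedCover.d_two_apply]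
  refine Int.cast_injective (α := ℝ) ?_
  change ((n'.1 i (PointedCover.refineIncl h' i x) - n.1 i (PointedCover.refineIncl h i x) : ℤ) :
    ℝ) = _
  push_cast
  rw [h0, h1, h2, h3, e1, e2]
  change D'.w (i 1) (i 2) (i 3) x - D'.w (i 0) (i 2) (i 3) x
        + D'.w (i 0) (i 1) (i 3) x - D'.w (i 0) (i 1) (i 2) x
      - (D.w (i 1) (i 2) (i 3) x - D.w (i 0) (i 2) (i 3) x
        + D.w (i 0) (i 1) (i 3) x - D.w (i 0) (i 1) (i 2) x) =
    D'.w (i 1) (i 2) (i 3) x - D.w (i 1) (i 2) (i 3) x -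
      (l (i 1) (i 2) x + l (i 2) (i 3) x - l (i 1) (i 3) x)
    - (D'.w (i 0) (i 2) (i 3) x - D.w (i 0) (i 2) (i 3) x -
      (l (i 0) (i 2) x + l (i 2) (i 3) x - l (i 0) (i 3) x))
    + (D'.w (i 0) (i 1) (i 3) x - D.w (i 0) (i 1) (i 3) x -
      (l (i 0) (i 1) x + l (i 1) (i 3) x - l (i 0) (i 3) x))
    - (D'.w (i 0) (i 1) (i 2) x - D.w (i 0) (i 1) (i 2) x -
      (l (i 0) (i 1) x + l (i 1) (i 2) x - l (i 0) (i 2) x))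
  ring

/-- The Dixmier–Douady class is well defined. -/
theorem GerbeCharts.existsUnique_isDDClass [I.Boundaryless] (hsurj : Function.Surjective π)
    (hsub : Manifold.IsSubmersion I J ∞ π) : ∃! c, 𝒜.IsDDClass J c := by
  obtain ⟨L⟩ := exists_localSections hsurj hsub
  obtain ⟨D⟩ := exists_ddData 𝒜 L
  obtain ⟨n, hn⟩ := D.exists_hasCocycle
  refine ⟨_, ⟨D, ⟨n, hn.mem_cocycles⟩, hn, rfl⟩, ?_⟩
  rintro _ ⟨D', n', hn', rfl⟩
  exact D'.cechClass_eq D n' ⟨n, hn.mem_cocycles⟩ hn' hn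

end Unique

/-! ## Trivialisations and vanishing of the class -/

section TrivialisationCharts

variable {E H Y M : Type*} [NormedAddCommGroup E] [NormedSpace ℝ E] [TopologicalSpace H]
  [TopologicalSpace Y] [ChartedSpace H Y] {π : Y → M} {I : ModelWithCorners ℝ E H}

/-- The part of `Y ×_M Y` over a pair of sets. -/
def fiberProdSet (π : Y → M) (U V : Set Y) : Set (Y × Y) :=
  {y | π y.1 = π y.2 ∧ y.1 ∈ U ∧ y.2 ∈ V}

theorem smoothPairAt_fst_snd {U V : Set Y} {y : Y × Y} (hy : y ∈ fiberProdSet π U V) :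
    SmoothPairAt π I (I.prod I) (fiberProdSet π U V) Prod.fst Prod.snd y :=
  ⟨hy, contMDiffWithinAt_fst, contMDiffWithinAt_snd, fun _ h => h.1⟩

/-- A trivialisation in terms of circle-valued functions. -/
structure TrivialisationCharts (𝒜 : GerbeCharts π I) where
  /-- open sets and functions on them -/
  atlas : Set (Set Y × (Y → Circle))
  isOpen : ∀ b ∈ atlas, IsOpen b.1
  cover : ∀ y, ∃ b ∈ atlas, y ∈ b.1
  compat : ∀ b ∈ atlas, ∀ b' ∈ atlas, ∀ y ∈ fiberProdSet π b.1 b'.1,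
    𝒜.SmoothAt (I.prod I) (fiberProdSet π b.1 b'.1) Prod.fst Prod.snd
      (fun y => b.2 y.1 * (b'.2 y.2)⁻¹) y

/-- On the diagonal a smooth section `f` of `P` is a smooth function, since `f = (f f) / f` is a
quotient of two smooth sections over the same pair. -/
theorem TrivialisationCharts.smooth {𝒜 : GerbeCharts π I} (T : TrivialisationCharts 𝒜) {b b'} (hb : b ∈ T.atlas) (hb' : b' ∈ T.atlas) :
    ContMDiffOn I (𝓡 1) ∞ (fun y => b.2 y * (b'.2 y)⁻¹) (b.1 ∩ b'.1) := by
  intro y hy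
  have hd : ContMDiffWithinAt I (I.prod I) ∞ (fun y : Y => (y, y)) (b.1 ∩ b'.1) y :=
    contMDiffWithinAt_id.prodMk contMDiffWithinAt_id
  have hp : SmoothPairAt π I I (b.1 ∩ b'.1) (fun y => y) (fun y => y) y :=
    ⟨hy, contMDiffWithinAt_id, contMDiffWithinAt_id, fun _ _ => rfl⟩
  have h1 : 𝒜.SmoothAt I (b.1 ∩ b'.1) (fun y => y) (fun y => y)
      (fun y => b.2 y * (b'.2 y)⁻¹) y :=
    GerbeCharts.SmoothAt.comp (φ := fun y => (y, y)) (T.compat b hb b' hb' (y, y) ⟨rfl, hy⟩) hd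
      fun z hz => ⟨rfl, hz⟩
  refine (GerbeCharts.SmoothAt.div hp (h1.mul hp hp h1) h1).congr_of_mem (fun z _ => ?_) hy
  rw [mul_inv_cancel_right]

end TrivialisationCharts

section Trivial

variable {E H Y F K M : Type*} [NormedAddCommGroup E] [NormedSpace ℝ E] [TopologicalSpace H]
  [TopologicalSpace Y] [ChartedSpace H Y]
  [NormedAddCommGroup F] [NormedSpace ℝ F] [TopologicalSpace K]
  [TopologicalSpace M] [ChartedSpace K M]
  {π : Y → M} {I : ModelWithCorners ℝ E H} {J : ModelWithCorners ℝ F K}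

namespace TrivialisationCharts

variable {𝒜 : GerbeCharts π I}

/-- Once each `s_a` takes values in the domain of one function `b_a` of the trivialisation,
`b_a(s_a) / b_c(s_c)` is a smooth section over `(s_a, s_c)`. These sections are strictly
multiplicative, so all logarithms can be taken to be `0`. -/
theorem isDDClass_zero (T : TrivialisationCharts 𝒜) (L : LocalSections π I J) :
    𝒜.IsDDClass J 0 := by
  choose b hb hbm using T.cover
  let 𝒱 : PointedCover M :=
    { U := fun a => L.cover.U a ∩ L.s a ⁻¹' (b (L.s a a)).1
      isOpen := fun a => (L.smooth a).continuousOn.isOpen_inter_preimage (L.cover.isOpen a)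
        (T.isOpen _ (hb _))
      mem := fun a => ⟨L.cover.mem a, hbm _⟩ }
  let D : DDData 𝒜 J :=
    { L := L.restrict 𝒱 id fun _ => Set.inter_subset_left
      τ := fun a c x => (b (L.s a a)).2 (L.s a x) * ((b (L.s c c)).2 (L.s c x))⁻¹
      smooth_τ := fun a c x hx => by
        have hp := (L.restrict 𝒱 id fun _ => Set.inter_subset_left).smoothPairAt subset_rfl hx
        exact GerbeCharts.SmoothAt.comp (φ := fun x => (L.s a x, L.s c x))
          (T.compat _ (hb (L.s a a)) _ (hb (L.s c c)) (L.s a x, L.s c x)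
            ⟨hp.eq x hx, hx.1.2, hx.2.2⟩) (hp.left.prodMk hp.right)
          fun z hz => ⟨hp.eq z hz, hz.1.2, hz.2.2⟩
      w := fun _ _ _ _ => 0
      smooth_w := fun _ _ _ => contMDiffOn_const
      exp_w := fun a c d x _ => by
        refine Additive.ofMul.injective ?_
        simp only [mul_zero, Circle.exp_zero, ofMul_mul, ofMul_inv, ofMul_one]
        abel }
  refine ⟨D, 0, fun i x => ?_, ?_⟩
  · change (((0 : ℤ) : ℤ) : ℝ) = 0 - 0 + 0 - 0
    simp
  · exact DirectLimit.zero_def _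

/-- A strict cocycle of sections over the overlaps defines a trivialisation. -/
theorem nonempty_of_strict (hπ : ContMDiff I J ∞ π) (L : LocalSections π I J)
    (τ : M → M → M → Circle) (hτ : ∀ a b, ∀ x ∈ L.overlap a b,
      𝒜.SmoothAt J (L.overlap a b) (L.s a) (L.s b) (τ a b) x)
    (hs : ∀ a b c, ∀ x ∈ L.cover.U a ∩ L.cover.U b ∩ L.cover.U c,
      τ a b x * τ b c x = τ a c x) :
    Nonempty (TrivialisationCharts 𝒜) := by
  -- The bundle has fibre `P_(y, s_m(m))` at `y`, where `m = π y` and the index `m` is available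
  -- because the cover is pointed. This reference varies discontinuously; the factor `τ a m m` moves
  -- the smooth section over `(y, s_a(m))` to it.
  refine ⟨{
    atlas := {b | ∃ a, ∃ e ∈ 𝒜.atlas, b = (π ⁻¹' L.cover.U a ∩ (fun y => (y, L.s a (π y))) ⁻¹' e.1,
      fun y => e.2 (y, L.s a (π y)) * τ a (π y) (π y))}
    isOpen := ?_, cover := ?_, compat := ?_ }⟩
  · rintro _ ⟨a, e, he, rfl⟩
    have hc : ContinuousOn (fun y => (y, L.s a (π y))) (π ⁻¹' L.cover.U a) :=
      continuousOn_id.prodMk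
        ((L.smooth a).continuousOn.comp hπ.continuous.continuousOn fun _ h => h)
    exact hc.isOpen_inter_preimage ((L.cover.isOpen a).preimage hπ.continuous) (𝒜.isOpen e he)
  · intro y
    obtain ⟨e, he, hy⟩ := 𝒜.cover y (L.s (π y) (π y)) (L.proj _ _ (L.cover.mem _)).symm
    exact ⟨_, ⟨π y, e, he, rfl⟩, L.cover.mem _, hy⟩
  · rintro _ ⟨a, e, he, rfl⟩ _ ⟨a', e', he', rfl⟩ y hy
    set W := fiberProdSet π (π ⁻¹' L.cover.U a ∩ (fun y => (y, L.s a (π y))) ⁻¹' e.1)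
      (π ⁻¹' L.cover.U a' ∩ (fun y => (y, L.s a' (π y))) ⁻¹' e'.1)
    have hW : ∀ z ∈ W, π z.1 ∈ L.overlap a a' := fun z hz =>
      ⟨hz.2.1.1, by rw [hz.1]; exact hz.2.2.1⟩
    have hπ1 : ContMDiffWithinAt (I.prod I) J ∞ (fun z : Y × Y => π z.1) W y :=
      (hπ _).comp_contMDiffWithinAt y contMDiffWithinAt_fst
    have p0 : SmoothPairAt π I (I.prod I) W Prod.fst Prod.snd y := smoothPairAt_fst_snd hy
    have p2 : SmoothPairAt π I (I.prod I) W (fun z => L.s a (π z.1)) (fun z => L.s a' (π z.1)) y :=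
      SmoothPairAt.comp (φ := fun z : Y × Y => π z.1) (L.smoothPairAt subset_rfl (hW y hy)) hy hπ1
        hW
    have p1 : SmoothPairAt π I (I.prod I) W Prod.fst (fun z => L.s a (π z.1)) y :=
      ⟨hy, contMDiffWithinAt_fst, p2.left, fun z hz => (L.proj a _ (hW z hz).1).symm⟩
    have p3 : SmoothPairAt π I (I.prod I) W Prod.snd (fun z => L.s a' (π z.1)) y :=
      ⟨hy, contMDiffWithinAt_snd, p2.right,
        fun z hz => (hz.1.symm.trans (L.proj a' _ (hW z hz).2).symm)⟩
    have f1 := GerbeCharts.smoothAt_chart p1 he hy.2.1.2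
    have f2 : 𝒜.SmoothAt (I.prod I) W (fun z => L.s a (π z.1)) (fun z => L.s a' (π z.1))
        (fun z => τ a a' (π z.1)) y :=
      GerbeCharts.SmoothAt.comp (φ := fun z : Y × Y => π z.1) (hτ a a' _ (hW y hy)) hπ1 hW
    have f3 := GerbeCharts.smoothAt_chart p3 he' (by rw [hy.1]; exact hy.2.2.2)
    -- By strictness the two reference factors combine to `τ a a'`. What remains is a product of
    -- smooth sections along the path `y₁ → s_a → s_a' → y₂`.
    refine ((f1.mul p1 p2 f2).mul (p1.trans p2) p3.symm (f3.inv p3)).congr hy fun z hz => ?_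
    have h1 := hs a a' (π z.1) (π z.1) ⟨hW z hz, L.cover.mem _⟩
    dsimp only
    rw [← hz.1, ← h1]
    refine Additive.ofMul.injective ?_
    simp only [ofMul_mul, ofMul_inv]
    abel

end TrivialisationCharts

/-! ### From a vanishing class to a trivialisation -/

/-- The sheaf of smooth real-valued functions is acyclic. -/
theorem exists_smooth_primitive [FiniteDimensional ℝ F] [T2Space M] [SigmaCompactSpace M]
    [IsManifold J ∞ M] (𝒱 : PointedCover M) (w : M → M → M → M → ℝ)
    (hw : ∀ a b c, ContMDiffOn J 𝓘(ℝ, ℝ) ∞ (w a b c) (𝒱.U a ∩ 𝒱.U b ∩ 𝒱.U c))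
    (hd : ∀ a b c d x, x ∈ 𝒱.U a → x ∈ 𝒱.U b → x ∈ 𝒱.U c → x ∈ 𝒱.U d →
      w b c d x - w a c d x + w a b d x - w a b c x = 0) :
    ∃ v : M → M → M → ℝ, (∀ a b, ContMDiffOn J 𝓘(ℝ, ℝ) ∞ (v a b) (𝒱.U a ∩ 𝒱.U b)) ∧
      ∀ a b c, ∀ x ∈ 𝒱.U a ∩ 𝒱.U b ∩ 𝒱.U c, w a b c x = v b c x - v a c x + v a b x := by
  obtain ⟨ρ, hρ⟩ := SmoothPartitionOfUnity.exists_isSubordinate J isClosed_univ 𝒱.U 𝒱.isOpen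
    fun x _ => Set.mem_iUnion.2 ⟨x, 𝒱.mem x⟩
  -- The contracting homotopy of a fine sheaf. Each summand is smooth on the overlap since `ρ t` is
  -- supported in `𝒱.U t`; the cocycle identity for `t, a, b, c`, averaged over `t`, gives the
  -- claim.
  refine ⟨fun a b x => ∑ᶠ t, ρ t x • w t a b x, fun a b x hx => ?_, ?_⟩
  · refine ContMDiffAt.contMDiffWithinAt (ρ.contMDiffAt_finsum fun t ht => ?_)
    exact (hw t a b).contMDiffAt
      ((((𝒱.isOpen t).inter (𝒱.isOpen a)).inter (𝒱.isOpen b)).mem_nhds ⟨⟨hρ t ht, hx.1⟩, hx.2⟩)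
  · rintro a b c x ⟨⟨ha, hb⟩, hc⟩
    simp only [← ρ.sum_finsupport_smul_eq_finsum]
    rw [← Finset.sum_sub_distrib, ← Finset.sum_add_distrib]
    have h1 : w a b c x = ∑ t ∈ ρ.finsupport x, ρ t x • w a b c x := by
      rw [← Finset.sum_smul, ρ.sum_finsupport x (Set.mem_univ x), one_smul]
    rw [h1]
    refine Finset.sum_congr rfl fun t ht => ?_
    have ht' : x ∈ 𝒱.U t := hρ t (subset_tsupport _ ((ρ.mem_finsupport x).1 ht))
    have h2 := hd t a b c x ht' ha hb hc
    simp only [smul_eq_mul]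
    linear_combination (ρ t x) * h2

theorem PointedCover.isOpen_inter {k : ℕ} (𝒱 : PointedCover M) (i : Fin k → M) :
    IsOpen (𝒱.inter i) := by
  have : 𝒱.inter i = ⋂ a, 𝒱.U (i a) := by
    ext x
    simp [PointedCover.inter]
  rw [this]
  exact isOpen_iInter_of_finite fun a => 𝒱.isOpen _

open Classical in
/-- The value of a cochain at a point, `0` outside the intersection. -/
def PointedCover.val {𝒱 : PointedCover M} {k : ℕ} (b : 𝒱.Cochain k) (i : Fin (k + 1) → M)
    (x : M) : ℤ :=
  if h : x ∈ 𝒱.inter i then b i ⟨x, h⟩ else 0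

theorem PointedCover.val_of_mem {𝒱 : PointedCover M} {k : ℕ} (b : 𝒱.Cochain k)
    (i : Fin (k + 1) → M) (x : 𝒱.inter i) : b i x = PointedCover.val b i x := by
  rw [PointedCover.val, dif_pos x.2]

theorem PointedCover.contMDiffAt_val {𝒱 : PointedCover M} {k : ℕ} (b : 𝒱.Cochain k)
    {i : Fin (k + 1) → M} {x : M} (hx : x ∈ 𝒱.inter i) :
    ContMDiffAt J 𝓘(ℝ, ℝ) ∞ (fun x => (PointedCover.val b i x : ℝ)) x := by
  have h1 : ∀ᶠ y in 𝓝 (⟨x, hx⟩ : 𝒱.inter i), b i y = b i ⟨x, hx⟩ :=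
    (b i).isLocallyConstant.eventually_eq _
  have h2 : ∀ᶠ y in 𝓝 x, PointedCover.val b i y = PointedCover.val b i x := by
    rw [← (𝒱.isOpen_inter i).isOpenEmbedding_subtypeVal.map_nhds_eq ⟨x, hx⟩, Filter.eventually_map]
    filter_upwards [h1] with y hy
    rw [← PointedCover.val_of_mem, hy]
    exact PointedCover.val_of_mem b i ⟨x, hx⟩
  refine (contMDiffAt_const (c := (PointedCover.val b i x : ℝ))).congr_of_eventuallyEq ?_
  filter_upwards [h2] with y hy
  rw [hy]

theorem PointedCover.val_d_two {𝒱 : PointedCover M} (b : 𝒱.Cochain 2) (p q r s : M) {x : M}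
    (hx : x ∈ 𝒱.inter ![p, q, r, s]) :
    𝒱.d 2 b ![p, q, r, s] ⟨x, hx⟩ = PointedCover.val b ![q, r, s] x -
      PointedCover.val b ![p, r, s] x + PointedCover.val b ![p, q, s] x -
      PointedCover.val b ![p, q, r] x := by
  rw [PointedCover.d_two_apply]
  simp only [PointedCover.val_of_mem]
  have h0 : ![p, q, r, s] ∘ (0 : Fin 4).succAbove = ![q, r, s] := by ext j; fin_cases j <;> rfl
  have h1 : ![p, q, r, s] ∘ (1 : Fin 4).succAbove = ![p, r, s] := by ext j; fin_cases j <;> rfl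
  have h2 : ![p, q, r, s] ∘ (2 : Fin 4).succAbove = ![p, q, s] := by ext j; fin_cases j <;> rfl
  have h3 : ![p, q, r, s] ∘ (3 : Fin 4).succAbove = ![p, q, r] := by ext j; fin_cases j <;> rfl
  exact congrArg₂ _ (congrArg₂ _ (congrArg₂ _ (congrArg (PointedCover.val b · x) h0)
    (congrArg (PointedCover.val b · x) h1)) (congrArg (PointedCover.val b · x) h2))
    (congrArg (PointedCover.val b · x) h3)

/-- On a finer cover `n = δb`, so `w - b` is a smooth real cocycle with a primitive `v`. Since `b`
is integer-valued it disappears under the exponential, and `exp(-2πi v) τ` is strictly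
multiplicative. -/
theorem TrivialisationCharts.nonempty_of_isDDClass_zero [FiniteDimensional ℝ F] [T2Space M]
    [SigmaCompactSpace M] [IsManifold J ∞ M] {𝒜 : GerbeCharts π I} (hπ : ContMDiff I J ∞ π)
    (h : 𝒜.IsDDClass J 0) : Nonempty (TrivialisationCharts 𝒜) := by
  obtain ⟨D, n, hn, h0⟩ := h
  obtain ⟨𝒱, h𝒱, b, hb⟩ := exists_eq_d_of_cechClass_eq_zero n h0.symm
  have hmem3 : ∀ {p q r x}, x ∈ 𝒱.U p ∩ 𝒱.U q ∩ 𝒱.U r → x ∈ 𝒱.inter ![p, q, r] := by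
    rintro p q r x ⟨⟨hp, hq⟩, hr⟩ j
    fin_cases j <;> assumption
  have hD : ∀ p q r, 𝒱.U p ∩ 𝒱.U q ∩ 𝒱.U r ⊆
      D.L.cover.U p ∩ D.L.cover.U q ∩ D.L.cover.U r := fun p q r =>
    Set.inter_subset_inter (Set.inter_subset_inter (h𝒱 p) (h𝒱 q)) (h𝒱 r)
  obtain ⟨v, hv, hwv⟩ := exists_smooth_primitive (J := J) 𝒱
    (fun p q r x => D.w p q r x - PointedCover.val b ![p, q, r] x)
    (fun p q r x hx => by
      have h1 := (D.smooth_w p q r x (hD p q r hx)).mono (hD p q r)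
      exact h1.sub (PointedCover.contMDiffAt_val b (hmem3 hx)).contMDiffWithinAt)
    (fun p q r s x hp hq hr hs => by
      have hx : x ∈ 𝒱.inter ![p, q, r, s] := by
        intro j
        fin_cases j <;> assumption
      have h1 := PointedCover.val_d_two b p q r s hx
      rw [← hb] at h1
      have h2 := hn ![p, q, r, s] (PointedCover.refineIncl h𝒱 _ ⟨x, hx⟩)
      have h3 : n.1 ![p, q, r, s] (PointedCover.refineIncl h𝒱 _ ⟨x, hx⟩) =
        PointedCover.res h𝒱 3 n.1 ![p, q, r, s] ⟨x, hx⟩ := rfl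
      rw [h3, h1] at h2
      have h4 : ((PointedCover.val b ![q, r, s] x - PointedCover.val b ![p, r, s] x +
          PointedCover.val b ![p, q, s] x - PointedCover.val b ![p, q, r] x : ℤ) : ℝ) =
          D.w q r s x - D.w p r s x + D.w p q s x - D.w p q r x := h2
      push_cast at h4
      linarith)
  have hoD : ∀ p q, 𝒱.U p ∩ 𝒱.U q ⊆ D.L.overlap p q := fun p q =>
    Set.inter_subset_inter (h𝒱 p) (h𝒱 q)
  refine nonempty_of_strict hπ (D.L.restrict 𝒱 id h𝒱)
    (fun p q x => Circle.exp (2 * Real.pi * -v p q x) * D.τ p q x) (fun p q x hx => ?_)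
    fun p q r x hx => ?_
  · exact GerbeCharts.SmoothAt.contMDiff_mul hx
      (ContMDiffOn.circleExp (hv p q).neg x hx) ((D.smooth_τ p q x (hoD p q hx)).mono (hoD p q))
  · have h1 := D.exp_w p q r x (hD p q r hx)
    have h2 : D.w p q r x = v q r x - v p r x + v p q x + PointedCover.val b ![p, q, r] x := by
      rw [← hwv p q r x hx]
      ring
    rw [h2] at h1
    simp only [mul_sub, mul_add, Circle.exp_add, Circle.exp_sub, Circle.exp_two_pi_mul_int,
      mul_one, mul_neg, Circle.exp_neg] at h1 ⊢
    have h3 : D.τ p q x * D.τ q r x = D.τ p q x * D.τ q r x * (D.τ p r x)⁻¹ * D.τ p r x := by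
      rw [inv_mul_cancel_right]
    rw [mul_mul_mul_comm, h3, ← h1]
    refine Additive.ofMul.injective ?_
    simp only [ofMul_mul, ofMul_inv, ofMul_div]
    abel

end Trivial

/-! ## Multiplicative sections of bundle gerbes -/

section Smooth

variable {E H X B : Type*} [NormedAddCommGroup E] [NormedSpace ℝ E] [TopologicalSpace H]
  [TopologicalSpace X] [ChartedSpace H X] [TopologicalSpace B]
  {I : ModelWithCorners ℝ E H} {ι : B → X}

/-- Smoothness on the set `ι '' U` depends only on the values there, so any function with the right
values can replace the one supplied by `SmoothOn`. -/
theorem smoothOn_iff {U : Set B} {g : B → Circle} {g' : X → Circle}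
    (hg : ∀ b ∈ U, g b = g' (ι b)) :
    SmoothOn I ι U g ↔ ContMDiffOn I (𝓡 1) ∞ g' (ι '' U) := by
  refine ⟨?_, fun h => ⟨g', h, hg⟩⟩
  rintro ⟨f, hf, hgf⟩
  refine hf.congr ?_
  rintro _ ⟨b, hb, rfl⟩
  rw [← hg b hb, hgf b hb]

theorem CircleBundle.Iso.map_sdiv {P Q : CircleBundle.{w} I ι} (f : P.Iso Q) (b : B)
    (p q : P.fiber b) : f.toFun b p /ₛ f.toFun b q = p /ₛ q := by
  conv_lhs => rw [← sdiv_smul p q, f.equivariant, smul_sdiv]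

end Smooth

section Sections

variable {E H Y M : Type*} [NormedAddCommGroup E] [NormedSpace ℝ E] [TopologicalSpace H]
  [TopologicalSpace Y] [ChartedSpace H Y]
  {π : Y → M} {I : ModelWithCorners ℝ E H}

namespace BundleGerbe

variable (G : BundleGerbe.{w} π I)

theorem mul_sdiv {y₁ y₂ y₃ : Y} (h₁₂ : π y₁ = π y₂) (h₂₃ : π y₂ = π y₃)
    (p p' : G.P.fiber ⟨(y₁, y₂), h₁₂⟩) (q q' : G.P.fiber ⟨(y₂, y₃), h₂₃⟩) :
    G.mul h₁₂ h₂₃ p q /ₛ G.mul h₁₂ h₂₃ p' q' = (p /ₛ p') * (q /ₛ q') :=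
  G.m.map_sdiv _ _ _

theorem smul_mul_smul {y₁ y₂ y₃ : Y} (h₁₂ : π y₁ = π y₂) (h₂₃ : π y₂ = π y₃)
    (z z' : Circle) (p : G.P.fiber ⟨(y₁, y₂), h₁₂⟩) (q : G.P.fiber ⟨(y₂, y₃), h₂₃⟩) :
    G.mul h₁₂ h₂₃ (z • p) (z' • q) = (z * z') • G.mul h₁₂ h₂₃ p q := by
  rw [eq_smul_iff_sdiv_eq, mul_sdiv, smul_sdiv, smul_sdiv]

/-- A multiplicative section of the bundle of a bundle gerbe, not necessarily continuous. -/
structure MulSection where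
  /-- the section -/
  q : ∀ b : Y2 π, G.P.fiber b
  mul : ∀ (y₁ y₂ y₃ : Y) (h₁₂ : π y₁ = π y₂) (h₂₃ : π y₂ = π y₃),
    G.mul h₁₂ h₂₃ (q ⟨(y₁, y₂), h₁₂⟩) (q ⟨(y₂, y₃), h₂₃⟩) = q ⟨(y₁, y₃), h₁₂.trans h₂₃⟩

/-- With a set-theoretic section `s` of `π` and arbitrary elements `u`, the element over `(y₁, y₂)`
is rescaled to `q` with `q(y₁, y₂) u(y₂, s) = u(y₁, s)`. By associativity `q(y₁, y₂) q(y₂, y₃)` and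
`q(y₁, y₃)` have the same product with `u(y₃, s)`, hence agree. -/
theorem nonempty_mulSection (hsurj : Function.Surjective π) : Nonempty G.MulSection := by
  let s := Function.surjInv hsurj
  have hs : ∀ m, π (s m) = m := Function.surjInv_eq hsurj
  have u : ∀ b, G.P.fiber b := fun b => ((G.P.fiber b).torsor.nonempty).some
  have hz : ∀ b : Y2 π, π b.1.1 = π (s (π b.1.1)) := fun b => (hs _).symm
  let q : ∀ b : Y2 π, G.P.fiber b := fun b =>
    (u ⟨(b.1.1, s (π b.1.1)), hz b⟩ /ₛ
      G.mul b.2 (b.2.symm.trans (hz b)) (u b) (u ⟨(b.1.2, s (π b.1.1)), b.2.symm.trans (hz b)⟩)) •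
      u b
  -- The variable `z` allows use at `y₂` with the base point written `s (π y₁)`, which avoids
  -- transport between fibres.
  have hq : ∀ (y₁ y₂ z : Y) (h₁₂ : π y₁ = π y₂) (h₂ : π y₂ = π z), z = s (π y₁) →
      G.mul h₁₂ h₂ (q ⟨(y₁, y₂), h₁₂⟩) (u ⟨(y₂, z), h₂⟩) = u ⟨(y₁, z), h₁₂.trans h₂⟩ := by
    rintro y₁ y₂ z h₁₂ h₂ rfl
    have := G.smul_mul_smul h₁₂ h₂ (u ⟨(y₁, s (π y₁)), h₁₂.trans h₂⟩ /ₛ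
      G.mul h₁₂ h₂ (u ⟨(y₁, y₂), h₁₂⟩) (u ⟨(y₂, s (π y₁)), h₂⟩)) 1 (u ⟨(y₁, y₂), h₁₂⟩)
      (u ⟨(y₂, s (π y₁)), h₂⟩)
    rw [one_smul, mul_one, sdiv_smul] at this
    exact this
  refine ⟨q, fun y₁ y₂ y₃ h₁₂ h₂₃ => ?_⟩
  have h3 : π y₃ = π (s (π y₁)) := (h₁₂.trans h₂₃).symm.trans (hs _).symm
  have e1 := hq y₁ y₃ (s (π y₁)) (h₁₂.trans h₂₃) h3 rfl
  have e2 := hq y₁ y₂ (s (π y₁)) h₁₂ (h₂₃.trans h3) rfl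
  have e3 := hq y₂ y₃ (s (π y₁)) h₂₃ h3 (by rw [h₁₂])
  have e4 := G.assoc y₁ y₂ y₃ (s (π y₁)) h₁₂ h₂₃ h3 (q ⟨(y₁, y₂), h₁₂⟩) (q ⟨(y₂, y₃), h₂₃⟩)
    (u ⟨(y₃, s (π y₁)), h3⟩)
  change G.mul (h₁₂.trans h₂₃) h3 (G.mul h₁₂ h₂₃ _ _) _ =
    G.mul h₁₂ (h₂₃.trans h3) _ (G.mul h₂₃ h3 _ _) at e4
  rw [e3, e2, ← e1] at e4
  have e5 := G.mul_sdiv (h₁₂.trans h₂₃) h3 (G.mul h₁₂ h₂₃ (q ⟨(y₁, y₂), h₁₂⟩)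
    (q ⟨(y₂, y₃), h₂₃⟩)) (q ⟨(y₁, y₃), h₁₂.trans h₂₃⟩) (u ⟨(y₃, s (π y₁)), h3⟩)
    (u ⟨(y₃, s (π y₁)), h3⟩)
  rw [e4, sdiv_self, sdiv_self, mul_one] at e5
  exact eq_of_sdiv_eq_one e5.symm

namespace MulSection

variable {G} (q : G.MulSection)

open Classical in
/-- The circle-valued function of a section. -/
def coord (s : ∀ b, G.P.fiber b) (y : Y × Y) : Circle :=
  if h : π y.1 = π y.2 then s ⟨y, h⟩ /ₛ q.q ⟨y, h⟩ else 1

theorem coord_val (s : ∀ b, G.P.fiber b) (b : Y2 π) : q.coord s b.1 = s b /ₛ q.q b :=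
  dif_pos b.2

theorem sdiv_eq_coord (s : ∀ b, G.P.fiber b) (b : Y2 π) (p : G.P.fiber b) :
    p /ₛ s b = (p /ₛ q.q b) * (q.coord s b.1)⁻¹ := by
  rw [coord_val, inv_sdiv_eq_sdiv_rev, sdiv_mul_sdiv_cancel]

theorem mul_sdiv_q {y₁ y₂ y₃ : Y} (h₁₂ : π y₁ = π y₂) (h₂₃ : π y₂ = π y₃)
    (p : G.P.fiber ⟨(y₁, y₂), h₁₂⟩) (p' : G.P.fiber ⟨(y₂, y₃), h₂₃⟩) :
    G.mul h₁₂ h₂₃ p p' /ₛ q.q ⟨(y₁, y₃), h₁₂.trans h₂₃⟩ =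
      (p /ₛ q.q ⟨(y₁, y₂), h₁₂⟩) * (p' /ₛ q.q ⟨(y₂, y₃), h₂₃⟩) := by
  rw [← q.mul y₁ y₂ y₃ h₁₂ h₂₃, mul_sdiv]

/-- A bundle gerbe with a multiplicative section in terms of circle-valued functions. -/
def charts : GerbeCharts π I where
  atlas := {c | ∃ e ∈ G.P.atlas, IsOpen c.1 ∧ Subtype.val ⁻¹' c.1 = e.1 ∧ c.2 = q.coord e.2}
  isOpen := by
    rintro c ⟨e, he, hc, -⟩
    exact hc
  cover y₁ y₂ h := by
    obtain ⟨e, he, hy⟩ := G.P.cover ⟨(y₁, y₂), h⟩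
    obtain ⟨O, hO, hOe⟩ := isOpen_induced_iff.1 (G.P.isOpen e he)
    refine ⟨(O, q.coord e.2), ⟨e, he, hO, hOe, rfl⟩, ?_⟩
    rw [← hOe] at hy
    exact hy
  smooth := by
    rintro ⟨O, c⟩ ⟨e, he, hO, hOe, hc⟩ ⟨O', c'⟩ ⟨e', he', hO', hOe', hc'⟩
    dsimp only at *
    have h1 := (smoothOn_iff (g' := fun y => c y * (c' y)⁻¹) fun b _ => by
      rw [q.sdiv_eq_coord e'.2, hc, hc', coord_val, coord_val]).1 (G.P.smooth e he e' he')
    refine h1.mono ?_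
    rintro y ⟨h, hy, hy'⟩
    exact ⟨⟨y, h⟩, ⟨hOe ▸ hy, hOe' ▸ hy'⟩, rfl⟩
  mul := by
    rintro ⟨O, c⟩ ⟨e, he, hO, hOe, hc⟩ ⟨O', c'⟩ ⟨e', he', hO', hOe', hc'⟩
      ⟨O'', c''⟩ ⟨e'', he'', hO'', hOe'', hc''⟩
    dsimp only at *
    have h0 := G.m.smooth _ ⟨_, ⟨e, he, rfl⟩, _, ⟨e', he', rfl⟩, rfl⟩ _ ⟨e'', he'', rfl⟩
    have h1 := (smoothOn_iff (g' := fun y : Y × Y × Y =>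
      c (y.1, y.2.1) * c' (y.2.1, y.2.2) * (c'' (y.1, y.2.2))⁻¹) fun b _ => by
        have h2 := q.mul_sdiv_q b.2.1 b.2.2 (e.2 (pr12 π b)) (e'.2 (pr23 π b))
        have h3 := q.sdiv_eq_coord e''.2 (pr13 π b)
          (G.mul b.2.1 b.2.2 (e.2 (pr12 π b)) (e'.2 (pr23 π b)))
        rw [hc, hc', hc'']
        refine h3.trans ?_
        refine congrArg₂ _ (h2.trans ?_) rfl
        exact congrArg₂ _ (q.coord_val e.2 (pr12 π b)).symm (q.coord_val e'.2 (pr23 π b)).symm).1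
          h0
    refine h1.mono ?_
    rintro y ⟨h, hy, hy', hy''⟩
    refine ⟨⟨y, h⟩, ⟨⟨?_, ?_⟩, ?_⟩, rfl⟩
    · change pr12 π ⟨y, h⟩ ∈ e.1
      rw [← hOe]
      exact hy
    · change pr23 π ⟨y, h⟩ ∈ e'.1
      rw [← hOe']
      exact hy'
    · change pr13 π ⟨y, h⟩ ∈ e''.1
      rw [← hOe'']
      exact hy''

theorem exists_mem_charts {e} (he : e ∈ G.P.atlas) :
    ∃ O, Subtype.val ⁻¹' O = e.1 ∧ (O, q.coord e.2) ∈ q.charts.atlas := by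
  obtain ⟨O, hO, hOe⟩ := isOpen_induced_iff.1 (G.P.isOpen e he)
  exact ⟨O, hOe, e, he, hO, hOe, rfl⟩

end MulSection

end BundleGerbe

end Sections

/-! ### The Dixmier–Douady class in terms of circle-valued functions -/

section Class

variable {E H Y F K M : Type*} [NormedAddCommGroup E] [NormedSpace ℝ E] [TopologicalSpace H]
  [TopologicalSpace Y] [ChartedSpace H Y]
  [NormedAddCommGroup F] [NormedSpace ℝ F] [TopologicalSpace K]
  [TopologicalSpace M] [ChartedSpace K M]
  {π : Y → M} {I : ModelWithCorners ℝ E H} {J : ModelWithCorners ℝ F K}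
  {G : BundleGerbe.{w} π I} (q : G.MulSection)

namespace BundleGerbe.MulSection

/-- Only the format differs: smoothness of the quotient by each chart on its whole domain, against
smoothness at each point for every chart defined there. Openness of the chart domains connects the
two. -/
theorem isSmoothSection_iff (L : LocalSections π I J) (a b : M)
    (σ : ∀ x : L.overlap a b, G.P.fiber (L.pair a b x)) (τ : M → Circle)
    (h : ∀ x : L.overlap a b, σ x /ₛ q.q (L.pair a b x) = τ x) :
    (G.P.pullback (L.pair a b) (L.isSmoothMap_pair a b)).IsSmoothSection Set.univ σ ↔
      ∀ x ∈ L.overlap a b, q.charts.SmoothAt J (L.overlap a b) (L.s a) (L.s b) τ x := by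
  have key : ∀ e ∈ G.P.atlas, ∀ O : Set (Y × Y), Subtype.val ⁻¹' O = e.1 →
      (SmoothOn J (Subtype.val : L.overlap a b → M) (Set.univ ∩ L.pair a b ⁻¹' e.1)
        (fun x => σ x /ₛ e.2 (L.pair a b x)) ↔
      ContMDiffOn J (𝓡 1) ∞ (fun x => τ x * (q.coord e.2 (L.s a x, L.s b x))⁻¹)
        (L.overlap a b ∩ (fun x => (L.s a x, L.s b x)) ⁻¹' O)) := by
    intro e he O hO
    have h1 : L.overlap a b ∩ (fun x => (L.s a x, L.s b x)) ⁻¹' O =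
        Subtype.val '' (Set.univ ∩ L.pair a b ⁻¹' e.1) := by
      ext x
      constructor
      · rintro ⟨hx, hxO⟩
        refine ⟨⟨x, hx⟩, ⟨trivial, ?_⟩, rfl⟩
        rw [← hO]
        exact hxO
      · rintro ⟨x, ⟨-, hx⟩, rfl⟩
        rw [← hO] at hx
        exact ⟨x.2, hx⟩
    rw [h1]
    refine smoothOn_iff fun x _ => ?_
    rw [q.sdiv_eq_coord e.2, h]
    rfl
  constructor
  · rintro hσ x hx c ⟨e, he, hO, hOe, hc⟩ hxc
    have h2 := (key e he c.1 hOe).1 (hσ _ ⟨e, he, rfl⟩) x ⟨hx, hxc⟩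
    rw [hc]
    refine h2.mono_of_mem_nhdsWithin (Filter.inter_mem self_mem_nhdsWithin ?_)
    have hp := L.smoothPairAt subset_rfl hx
    exact (hp.left.continuousWithinAt.prodMk hp.right.continuousWithinAt) (hO.mem_nhds hxc)
  · rintro hτ _ ⟨e, he, rfl⟩
    obtain ⟨O, hOe, hmem⟩ := q.exists_mem_charts he
    refine (key e he O hOe).2 fun x hx => ?_
    exact (hτ x hx.1 _ hmem hx.2).mono Set.inter_subset_left

/-- The correspondence is `σ = τ • q`. As `q` is multiplicative, `m(σ_ab, σ_bc) = g_abc σ_ac`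
becomes `τ_ab τ_bc = g_abc τ_ac`. -/
theorem isDDClass_iff (c : CechH M 3) : G.IsDDClass J c ↔ q.charts.IsDDClass J c := by
  classical
  constructor
  · rintro ⟨L, σ, g, w, n, hσ, hg, hw, hexp, hn, hc⟩
    let τ : M → M → M → Circle := fun a b x =>
      if hx : x ∈ L.overlap a b then σ a b ⟨x, hx⟩ /ₛ q.q (L.pair a b ⟨x, hx⟩) else 1
    have hτ : ∀ a b (x : L.overlap a b), σ a b x /ₛ q.q (L.pair a b x) = τ a b x :=
      fun a b x => by simp only [τ, dif_pos x.2]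
    refine ⟨⟨L, τ, fun a b => (q.isSmoothSection_iff L a b (σ a b) (τ a b) (hτ a b)).1 (hσ a b),
      w, hw, ?_⟩, n, hn, hc⟩
    rintro a b c x ⟨⟨ha, hb⟩, hc⟩
    have h1 := hg a b c x ha hb hc
    have h2 := q.mul_sdiv_q (L.fiber_eq ha hb) (L.fiber_eq hb hc) (σ a b ⟨x, ha, hb⟩)
      (σ b c ⟨x, hb, hc⟩)
    rw [h1] at h2
    have h3 : g a b c x * τ a c x = τ a b x * τ b c x := by
      rw [← hτ a b ⟨x, ha, hb⟩, ← hτ b c ⟨x, hb, hc⟩, ← hτ a c ⟨x, ha, hc⟩]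
      exact (smul_sdiv_assoc (g a b c x) (σ a c ⟨x, ha, hc⟩) _).symm.trans h2
    rw [hexp a b c x ⟨⟨ha, hb⟩, hc⟩, ← h3, mul_inv_cancel_right]
  · rintro ⟨D, n, hn, hc⟩
    refine ⟨D.L, fun a b x => D.τ a b x • q.q (D.L.pair a b x),
      fun a b c x => D.τ a b x * D.τ b c x * (D.τ a c x)⁻¹, D.w, n,
      fun a b => (q.isSmoothSection_iff D.L a b _ (D.τ a b) fun x => smul_sdiv _ _).2
        (D.smooth_τ a b), ?_, D.smooth_w, D.exp_w, hn, hc⟩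
    intro a b c x ha hb hc
    refine (G.smul_mul_smul (D.L.fiber_eq ha hb) (D.L.fiber_eq hb hc) _ _ _ _).trans ?_
    rw [smul_smul, inv_mul_cancel_right]
    exact congrArg _ (q.mul _ _ _ _ _)

end BundleGerbe.MulSection

end Class

/-! ## Trivialisations in terms of circle-valued functions -/

/-- The trivial `U(1)`-torsor. -/
def unitTorsor : CircleTorsor.{w} where
  carrier := ULift.{w} Circle
  torsor :=
    { smul := fun z p => ⟨z * p.down⟩
      one_smul := fun p => congrArg ULift.up (one_mul p.down)
      mul_smul := fun a b p => congrArg ULift.up (mul_assoc a b p.down)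
      sdiv := fun p q => p.down / q.down
      nonempty := ⟨⟨1⟩⟩
      sdiv_smul' := fun p q => congrArg ULift.up (div_mul_cancel p.down q.down)
      smul_sdiv' := fun z p => mul_div_cancel_right z p.down }

/-- The element of the trivial torsor given by an element of the circle. -/
def ofCircle (z : Circle) : unitTorsor.{w} := ULift.up z

theorem ofCircle_sdiv (z z' : Circle) : ofCircle.{w} z /ₛ ofCircle z' = z * z'⁻¹ :=
  div_eq_mul_inv z z'

/-- The `U(1)`-bundle over a manifold with an atlas of circle-valued functions. -/
def bundleOfFunctions {E H X : Type*} [NormedAddCommGroup E] [NormedSpace ℝ E]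
    [TopologicalSpace H] [TopologicalSpace X] [ChartedSpace H X] (I : ModelWithCorners ℝ E H)
    (A : Set (Set X × (X → Circle)))
    (isOpen : ∀ b ∈ A, IsOpen b.1) (cover : ∀ x, ∃ b ∈ A, x ∈ b.1)
    (smooth : ∀ b ∈ A, ∀ b' ∈ A, ContMDiffOn I (𝓡 1) ∞ (fun x => b.2 x * (b'.2 x)⁻¹)
      (b.1 ∩ b'.1)) : CircleBundle.{w} I (id : X → X) where
  fiber _ := unitTorsor
  atlas := {e | ∃ b ∈ A, e = (b.1, fun x => ofCircle (b.2 x))}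
  isOpen := by
    rintro _ ⟨b, hb, rfl⟩
    exact isOpen b hb
  cover x := by
    obtain ⟨b, hb, hx⟩ := cover x
    exact ⟨_, ⟨b, hb, rfl⟩, hx⟩
  smooth := by
    rintro _ ⟨b, hb, rfl⟩ _ ⟨b', hb', rfl⟩
    refine (smoothOn_iff (g' := fun x => b.2 x * (b'.2 x)⁻¹) fun x _ => ofCircle_sdiv _ _).2 ?_
    rw [Set.image_id]
    exact smooth b hb b' hb'

/-- The element `e ⊗ e*` is the unit for contraction on `A ⊗ A*`, so coordinates relative to it
multiply. This makes the isomorphism built in `trivialisationOfCharts` multiplicative. -/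
theorem contract_sdiv_base {A : CircleTorsor.{w}} (e : A) (p p' : A.tensor A.dual) :
    contract (tmul p p') /ₛ (tmul e (toDual e) : A.tensor A.dual) =
      (p /ₛ (tmul e (toDual e) : A.tensor A.dual)) *
        (p' /ₛ (tmul e (toDual e) : A.tensor A.dual)) := by
  have key : ∀ a b b' c : A,
      contract (tmul (tmul a (toDual b)) (tmul b' (toDual c))) /ₛ
        (tmul e (toDual e) : A.tensor A.dual) =
      ((tmul a (toDual b) : A.tensor A.dual) /ₛ (tmul e (toDual e) : A.tensor A.dual)) *
        ((tmul b' (toDual c) : A.tensor A.dual) /ₛ (tmul e (toDual e) : A.tensor A.dual)) := by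
    intro a b b' c
    rw [contract_sdiv, tmul_sdiv, tmul_sdiv, toDual_sdiv, toDual_sdiv,
      ← sdiv_mul_sdiv_cancel b' e b, ← inv_sdiv_eq_sdiv_rev b e]
    refine Additive.ofMul.injective ?_
    simp only [ofMul_mul, ofMul_inv]
    abel
  obtain ⟨a, b, rfl⟩ := tmul_surj p
  obtain ⟨b', c, rfl⟩ := tmul_surj p'
  exact key a (ofDual b) b' (ofDual c)

section Trivialisations

variable {E H Y M : Type*} [NormedAddCommGroup E] [NormedSpace ℝ E] [TopologicalSpace H]
  [TopologicalSpace Y] [ChartedSpace H Y]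
  {π : Y → M} {I : ModelWithCorners ℝ E H} {G : BundleGerbe.{w} π I} (q : G.MulSection)

namespace BundleGerbe

theorem Trivialisation.iso_sdiv (T : G.Trivialisation) {y₁ y₂ : Y} (h : π y₁ = π y₂)
    (p₁ r₁ : T.R.fiber y₁) (p₂ r₂ : T.R.fiber y₂) :
    T.iso.toFun ⟨(y₁, y₂), h⟩ (tmul p₁ (toDual p₂)) /ₛ
      T.iso.toFun ⟨(y₁, y₂), h⟩ (tmul r₁ (toDual r₂)) = (p₁ /ₛ r₁) * (p₂ /ₛ r₂)⁻¹ :=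
  T.iso.toIso.map_sdiv _ _ _

/-- A section of the bundle of a trivialisation, not necessarily continuous, which induces the
multiplicative section `q`. -/
structure AdaptedSection (T : G.Trivialisation) where
  /-- the section -/
  r : ∀ y, T.R.fiber y
  iso_r : ∀ (y₁ y₂ : Y) (h : π y₁ = π y₂),
    T.iso.toFun ⟨(y₁, y₂), h⟩ (tmul (r y₁) (toDual (r y₂))) = q.q ⟨(y₁, y₂), h⟩

/-- For an arbitrary section `r` the discrepancy `c` between the induced section of `P` and `q` is
multiplicative. A set-theoretic section `s` of `π` makes it a coboundary, `c(y₁, y₂) = c(y₁, s) /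
c(y₂, s)`, which is absorbed by rescaling `r`. -/
theorem nonempty_adaptedSection (hsurj : Function.Surjective π) (T : G.Trivialisation) :
    Nonempty (AdaptedSection q T) := by
  let s := Function.surjInv hsurj
  have hs : ∀ m, π (s m) = m := Function.surjInv_eq hsurj
  have r : ∀ y, T.R.fiber y := fun y => ((T.R.fiber y).torsor.nonempty).some
  let c : Y → Y → Circle := fun y₁ y₂ =>
    q.coord (fun b => T.iso.toFun b (tmul (r b.1.1) (toDual (r b.1.2)))) (y₁, y₂)
  have hc : ∀ y₁ y₂ (h : π y₁ = π y₂), c y₁ y₂ =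
      T.iso.toFun ⟨(y₁, y₂), h⟩ (tmul (r y₁) (toDual (r y₂))) /ₛ q.q ⟨(y₁, y₂), h⟩ :=
    fun y₁ y₂ h => q.coord_val _ ⟨(y₁, y₂), h⟩
  have hmul : ∀ y₁ y₂ y₃, π y₁ = π y₂ → π y₂ = π y₃ → c y₁ y₂ * c y₂ y₃ = c y₁ y₃ := by
    intro y₁ y₂ y₃ h₁₂ h₂₃
    rw [hc _ _ h₁₂, hc _ _ h₂₃, hc _ _ (h₁₂.trans h₂₃), ← q.mul_sdiv_q]
    refine congrArg (fun p => p /ₛ q.q ⟨(y₁, y₃), h₁₂.trans h₂₃⟩) ?_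
    have h1 := T.iso.map_mul y₁ y₂ y₃ h₁₂ h₂₃ (tmul (r y₁) (toDual (r y₂)))
      (tmul (r y₂) (toDual (r y₃)))
    rw [← h1]
    refine congrArg _ ?_
    refine (contract_tmul (r y₁) (r y₂) (r y₂) (r y₃)).trans ?_
    rw [sdiv_self]
    exact one_smul Circle (tmul (r y₁) (toDual (r y₃)))
  refine ⟨⟨fun y => (c y (s (π y)))⁻¹ • r y, fun y₁ y₂ h => ?_⟩⟩
  have h1 := hmul y₁ y₂ (s (π y₂)) h (hs _).symm
  have h2 : ((c y₁ (s (π y₁)))⁻¹ • r y₁ /ₛ r y₁) * ((c y₂ (s (π y₂)))⁻¹ • r y₂ /ₛ r y₂)⁻¹ =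
      (c y₁ y₂)⁻¹ := by
    rw [smul_sdiv, smul_sdiv, inv_inv, h, ← h1, mul_inv, inv_mul_cancel_right]
  have h3 := (T.iso_sdiv h _ (r y₁) _ (r y₂)).trans h2
  rw [← eq_smul_iff_sdiv_eq, hc _ _ h, inv_sdiv_eq_sdiv_rev, sdiv_smul] at h3
  exact h3

variable {q}

theorem AdaptedSection.iso_sdiv_q {T : G.Trivialisation} (r : AdaptedSection q T) {y₁ y₂ : Y}
    (h : π y₁ = π y₂) (p₁ : T.R.fiber y₁) (p₂ : T.R.fiber y₂) :
    T.iso.toFun ⟨(y₁, y₂), h⟩ (tmul p₁ (toDual p₂)) /ₛ q.q ⟨(y₁, y₂), h⟩ =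
      (p₁ /ₛ r.r y₁) * (p₂ /ₛ r.r y₂)⁻¹ := by
  rw [← r.iso_r, T.iso_sdiv]

/-- A trivialisation with an adapted section in terms of circle-valued functions. -/
def AdaptedSection.charts {T : G.Trivialisation} (r : AdaptedSection q T) :
    TrivialisationCharts q.charts where
  atlas := {c | ∃ e ∈ T.R.atlas, c = (e.1, fun y => e.2 y /ₛ r.r y)}
  isOpen := by
    rintro _ ⟨e, he, rfl⟩
    exact T.R.isOpen e he
  cover y := by
    obtain ⟨e, he, hy⟩ := T.R.cover y
    exact ⟨_, ⟨e, he, rfl⟩, hy⟩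
  compat := by
    rintro _ ⟨e, he, rfl⟩ _ ⟨e', he', rfl⟩ y hy c ⟨f, hf, hO, hOf, hc⟩ hyc
    have h0 := T.iso.smooth _ ⟨_, ⟨e, he, rfl⟩, _, ⟨_, ⟨e', he', rfl⟩, rfl⟩, rfl⟩ f hf
    have h1 := (smoothOn_iff (g' := fun y : Y × Y =>
      (e.2 y.1 /ₛ r.r y.1) * (e'.2 y.2 /ₛ r.r y.2)⁻¹ * (c.2 y)⁻¹) fun b _ => by
        rw [hc]
        refine (q.sdiv_eq_coord f.2 b _).trans (congrArg₂ _ ?_ rfl)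
        exact r.iso_sdiv_q b.2 _ _).1 h0
    have h2 : fiberProdSet π e.1 e'.1 ∩ c.1 ∈ 𝓝[fiberProdSet π e.1 e'.1] y :=
      Filter.inter_mem self_mem_nhdsWithin (mem_nhdsWithin_of_mem_nhds (hO.mem_nhds hyc))
    have h3 : fiberProdSet π e.1 e'.1 ∩ c.1 ⊆
        Subtype.val '' ((pr1 π ⁻¹' e.1 ∩ pr2 π ⁻¹' e'.1) ∩ f.1) := by
      rintro z ⟨⟨hz, hz1, hz2⟩, hzc⟩
      refine ⟨⟨z, hz⟩, ⟨⟨hz1, hz2⟩, ?_⟩, rfl⟩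
      rw [← hOf]
      exact hzc
    exact ((h1.mono h3) y ⟨hy, hyc⟩).mono_of_mem_nhdsWithin h2

/-- The trivialisation defined by circle-valued functions. -/
def trivialisationOfCharts (T : TrivialisationCharts q.charts) : G.Trivialisation where
  R := bundleOfFunctions I T.atlas T.isOpen T.cover fun _ hb _ hb' => T.smooth hb hb'
  iso :=
    -- All fibres of the bundle are the unit torsor, and `1 ⊗ 1*` goes to `q`. Smoothness of this
    -- map is then the `compat` condition.
    { toFun := fun b p => (p /ₛ (tmul (ofCircle 1) (toDual (ofCircle 1)) :
        unitTorsor.{w}.tensor unitTorsor.dual)) • q.q b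
      equivariant := fun b z p => by
        rw [← mul_smul]
        exact congrArg (· • q.q b) (smul_sdiv_assoc z p _)
      smooth := by
        rintro _ ⟨_, ⟨_, ⟨b, hb, rfl⟩, rfl⟩, _, ⟨_, ⟨_, ⟨b', hb', rfl⟩, rfl⟩, rfl⟩, rfl⟩ e he
        obtain ⟨O, hO, hmem⟩ := q.exists_mem_charts he
        refine (smoothOn_iff (g' := fun y : Y × Y =>
          (b.2 y.1 * (b'.2 y.2)⁻¹) * (q.coord e.2 y)⁻¹) fun y _ => ?_).2 ?_
        · refine (q.sdiv_eq_coord e.2 y _).trans (congrArg₂ _ ?_ rfl)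
          rw [smul_sdiv]
          refine (tmul_sdiv _ _ _ _).trans ?_
          refine (congrArg₂ _ (ofCircle_sdiv _ _) ((toDual_sdiv _ _).trans
            (congrArg _ (ofCircle_sdiv _ _)))).trans ?_
          rw [inv_one, mul_one, mul_one]
          rfl
        · rintro _ ⟨y, ⟨⟨h1, h2⟩, hy⟩, rfl⟩
          have hyO : y.1 ∈ O := by
            rw [← hO] at hy
            exact hy
          refine (T.compat b hb b' hb' y.1 ⟨y.2, h1, h2⟩ _ hmem hyO).mono ?_
          rintro _ ⟨z, ⟨⟨h1, h2⟩, -⟩, rfl⟩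
          exact ⟨z.2, h1, h2⟩
      map_mul := fun y₁ y₂ y₃ h₁₂ h₂₃ p p' => by
        rw [G.smul_mul_smul]
        refine congrArg₂ _ ?_ (q.mul _ _ _ _ _).symm
        exact contract_sdiv_base (ofCircle 1) p p' }

variable (q)

theorem isTrivial_iff (hsurj : Function.Surjective π) :
    G.IsTrivial ↔ Nonempty (TrivialisationCharts q.charts) := by
  constructor
  · rintro ⟨T⟩
    obtain ⟨r⟩ := nonempty_adaptedSection q hsurj T
    exact ⟨r.charts⟩
  · rintro ⟨T⟩
    exact ⟨trivialisationOfCharts T⟩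

end BundleGerbe

end Trivialisations

/-! ## The difference of two trivialisations -/

theorem smul_tmul_unit_sdiv {T : CircleTorsor.{w}} (z c : Circle) (r p : T) :
    (z • (tmul r (ofCircle 1) : T.tensor unitTorsor)) /ₛ
      (tmul p (ofCircle c) : T.tensor unitTorsor) = z * (p /ₛ r)⁻¹ * c⁻¹ := by
  rw [smul_sdiv_assoc, tmul_sdiv, ofCircle_sdiv, one_mul, inv_sdiv_eq_sdiv_rev, mul_assoc]

section Difference

variable {E H Y F K M : Type*} [NormedAddCommGroup E] [NormedSpace ℝ E] [TopologicalSpace H]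
  [TopologicalSpace Y] [ChartedSpace H Y]
  [NormedAddCommGroup F] [NormedSpace ℝ F] [TopologicalSpace K]
  [TopologicalSpace M] [ChartedSpace K M]
  {π : Y → M} {I : ModelWithCorners ℝ E H} {J : ModelWithCorners ℝ F K}

namespace TrivialisationCharts

variable {𝒜 : GerbeCharts π I} (T₁ T₂ : TrivialisationCharts 𝒜)

/-- Both `b₁(y₁) / b₁'(y₂)` and `b₂(y₁) / b₂'(y₂)` are smooth sections of the same gerbe bundle over
`(y₁, y₂)`. Rearranging their quotient compares `b₁/b₂` at `y₁` with `b₁'/b₂'` at another point `y₂`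
of the same fibre of `π`. -/
theorem contMDiffWithinAt_difference {b₁ b₁' b₂ b₂' : Set Y × (Y → Circle)} (h₁ : b₁ ∈ T₁.atlas)
    (h₁' : b₁' ∈ T₁.atlas) (h₂ : b₂ ∈ T₂.atlas) (h₂' : b₂' ∈ T₂.atlas) {y : Y × Y}
    (hy : y ∈ fiberProdSet π (b₁.1 ∩ b₂.1) (b₁'.1 ∩ b₂'.1)) :
    ContMDiffWithinAt (I.prod I) (𝓡 1) ∞
      (fun y => b₁.2 y.1 * (b₂.2 y.1)⁻¹ * (b₁'.2 y.2 * (b₂'.2 y.2)⁻¹)⁻¹)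
      (fiberProdSet π (b₁.1 ∩ b₂.1) (b₁'.1 ∩ b₂'.1)) y := by
  have s₁ : fiberProdSet π (b₁.1 ∩ b₂.1) (b₁'.1 ∩ b₂'.1) ⊆ fiberProdSet π b₁.1 b₁'.1 :=
    fun z hz => ⟨hz.1, hz.2.1.1, hz.2.2.1⟩
  have s₂ : fiberProdSet π (b₁.1 ∩ b₂.1) (b₁'.1 ∩ b₂'.1) ⊆ fiberProdSet π b₂.1 b₂'.1 :=
    fun z hz => ⟨hz.1, hz.2.1.2, hz.2.2.2⟩
  refine (GerbeCharts.SmoothAt.div (smoothPairAt_fst_snd hy)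
    ((T₁.compat _ h₁ _ h₁' y (s₁ hy)).mono s₁)
    ((T₂.compat _ h₂ _ h₂' y (s₂ hy)).mono s₂)).congr_of_mem (fun z _ => ?_) hy
  refine Additive.ofMul.injective ?_
  simp only [ofMul_mul, ofMul_inv]
  abel

/-- The functions on `M` which define the difference of two trivialisations. -/
def differenceAtlas (L : LocalSections π I J) : Set (Set M × (M → Circle)) :=
  {c | ∃ a, ∃ b₁ ∈ T₁.atlas, ∃ b₂ ∈ T₂.atlas, c = (L.cover.U a ∩ L.s a ⁻¹' (b₁.1 ∩ b₂.1),
    fun m => b₁.2 (L.s a m) * (b₂.2 (L.s a m))⁻¹)}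

theorem isOpen_differenceAtlas (L : LocalSections π I J) :
    ∀ c ∈ differenceAtlas T₁ T₂ L, IsOpen c.1 := by
  rintro _ ⟨a, b₁, h₁, b₂, h₂, rfl⟩
  exact (L.smooth a).continuousOn.isOpen_inter_preimage (L.cover.isOpen a)
    ((T₁.isOpen b₁ h₁).inter (T₂.isOpen b₂ h₂))

theorem cover_differenceAtlas (L : LocalSections π I J) (m : M) :
    ∃ c ∈ differenceAtlas T₁ T₂ L, m ∈ c.1 := by
  obtain ⟨b₁, h₁, hm₁⟩ := T₁.cover (L.s m m)
  obtain ⟨b₂, h₂, hm₂⟩ := T₂.cover (L.s m m)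
  exact ⟨_, ⟨m, b₁, h₁, b₂, h₂, rfl⟩, L.cover.mem m, hm₁, hm₂⟩

/-- The transition functions are the comparison above pulled back along `(s_a, s_a')`. -/
theorem smooth_differenceAtlas (L : LocalSections π I J) :
    ∀ c ∈ differenceAtlas T₁ T₂ L, ∀ c' ∈ differenceAtlas T₁ T₂ L,
      ContMDiffOn J (𝓡 1) ∞ (fun m => c.2 m * (c'.2 m)⁻¹) (c.1 ∩ c'.1) := by
  rintro _ ⟨a, b₁, h₁, b₂, h₂, rfl⟩ _ ⟨a', b₁', h₁', b₂', h₂', rfl⟩ m hm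
  have hmaps : Set.MapsTo (fun m => (L.s a m, L.s a' m))
      ((L.cover.U a ∩ L.s a ⁻¹' (b₁.1 ∩ b₂.1)) ∩ (L.cover.U a' ∩ L.s a' ⁻¹' (b₁'.1 ∩ b₂'.1)))
      (fiberProdSet π (b₁.1 ∩ b₂.1) (b₁'.1 ∩ b₂'.1)) := fun x hx =>
    ⟨L.fiber_eq hx.1.1 hx.2.1, hx.1.2, hx.2.2⟩
  refine ContMDiffWithinAt.comp (f := fun m => (L.s a m, L.s a' m)) m
    (contMDiffWithinAt_difference T₁ T₂ h₁ h₁' h₂ h₂' (hmaps hm)) ?_ hmaps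
  exact ((L.smooth a m hm.1.1).mono fun x hx => hx.1.1).prodMk
    ((L.smooth a' m hm.2.1).mono fun x hx => hx.2.1)

end TrivialisationCharts

namespace BundleGerbe

variable {G : BundleGerbe.{w} π I} {q : G.MulSection}

open TrivialisationCharts in
/-- The `U(1)`-bundle on `M` by which two trivialisations differ. -/
def differenceBundle {T₁ T₂ : G.Trivialisation} (r₁ : AdaptedSection q T₁)
    (r₂ : AdaptedSection q T₂) (L : LocalSections π I J) : CircleBundle.{w} J (id : M → M) :=
  bundleOfFunctions J (differenceAtlas r₁.charts r₂.charts L) (isOpen_differenceAtlas _ _ L)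
    (cover_differenceAtlas _ _ L) (smooth_differenceAtlas _ _ L)

theorem sdiv_ofCircle_cast {T₁ T₂ : G.Trivialisation} (r₁ : AdaptedSection q T₁)
    (r₂ : AdaptedSection q T₂) (L : LocalSections π I J) {m m' : M} (h : m = m')
    (t : (differenceBundle r₁ r₂ L).fiber m) :
    ((h ▸ t : (differenceBundle r₁ r₂ L).fiber m') : unitTorsor.{w}) /ₛ ofCircle.{w} 1 =
      (t : unitTorsor.{w}) /ₛ ofCircle.{w} 1 := by
  subst h
  rfl

theorem differBy_differenceBundle {T₁ T₂ : G.Trivialisation} (r₁ : AdaptedSection q T₁)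
    (r₂ : AdaptedSection q T₂) (L : LocalSections π I J) (hπ : ContMDiff I J ∞ π) :
    T₁.DifferBy T₂ hπ (differenceBundle r₁ r₂ L) := by
  -- The isomorphism sends `r₁` to `o = r₂ ⊗ 1`. Both adapted sections induce the same `q`, which
  -- makes it compatible with the two trivialisations.
  let o : ∀ y, (T₂.R.tensor ((differenceBundle r₁ r₂ L).pullback π
      (isSmoothMap_of_contMDiff hπ))).fiber y := fun y =>
    tmul (S := T₂.R.fiber y) (T := unitTorsor) (r₂.r y) (ofCircle 1)
  have ho : ∀ y (p : T₂.R.fiber y) (t : unitTorsor.{w}),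
      (tmul (S := T₂.R.fiber y) (T := unitTorsor) p t) /ₛ o y =
        (p /ₛ r₂.r y) * (t /ₛ ofCircle 1) := fun y p t => tmul_sdiv _ _ _ _
  have ho' : ∀ y (z c : Circle) (p : T₂.R.fiber y),
      (z • o y) /ₛ (tmul (S := T₂.R.fiber y) (T := unitTorsor) p (ofCircle c)) =
        z * (p /ₛ r₂.r y)⁻¹ * c⁻¹ := fun y z c p => smul_tmul_unit_sdiv z c (r₂.r y) p
  refine ⟨⟨fun y p => (p /ₛ r₁.r y) • o y, fun y z p => ?_, ?_⟩, ?_⟩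
  · rw [smul_sdiv_assoc, mul_smul]
  · rintro e₁ h₁ _ ⟨e₂, h₂, _, ⟨_, ⟨_, ⟨a, b₁, hb₁, b₂, hb₂, rfl⟩, rfl⟩, rfl⟩, rfl⟩
    have m₁ : (e₁.1, fun y => e₁.2 y /ₛ r₁.r y) ∈ r₁.charts.atlas := ⟨e₁, h₁, rfl⟩
    have m₂ : (e₂.1, fun y => e₂.2 y /ₛ r₂.r y) ∈ r₂.charts.atlas := ⟨e₂, h₂, rfl⟩
    refine (smoothOn_iff (g' := fun y => (e₁.2 y /ₛ r₁.r y) * (e₂.2 y /ₛ r₂.r y)⁻¹ *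
      (b₁.2 (L.s a (π y)) * (b₂.2 (L.s a (π y)))⁻¹)⁻¹) fun y _ => ?_).2 ?_
    · exact ho' y _ _ (e₂.2 y)
    · rw [Set.image_id]
      rintro y ⟨hy₁, hy₂, hya, hyb⟩
      -- In charts the isomorphism is the comparison of differences at the two points `y` and `s_a(π
      -- y)` of one fibre of `π`.
      have hmaps : Set.MapsTo (fun y => (y, L.s a (π y)))
          (e₁.1 ∩ (e₂.1 ∩ π ⁻¹' (L.cover.U a ∩ L.s a ⁻¹' (b₁.1 ∩ b₂.1))))
          (fiberProdSet π (e₁.1 ∩ e₂.1) (b₁.1 ∩ b₂.1)) := fun z hz =>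
        ⟨(L.proj a _ hz.2.2.1).symm, ⟨hz.1, hz.2.1⟩, hz.2.2.2⟩
      refine ContMDiffWithinAt.comp (f := fun y => (y, L.s a (π y))) y
        (TrivialisationCharts.contMDiffWithinAt_difference r₁.charts r₂.charts m₁ hb₁ m₂ hb₂
          (hmaps ⟨hy₁, hy₂, hya, hyb⟩)) ?_ hmaps
      exact contMDiffWithinAt_id.prodMk ((L.smooth a _ hya).comp y (hπ y).contMDiffWithinAt
        fun z hz => hz.2.2.1)
  · intro y₁ y₂ h p₁ p₂ u₁ u₂ t e₁ e₂
    -- The element `t` contributes the same factor at `y₁` and at `y₂`, so it cancels in `f₅`.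
    have f₁ : p₁ /ₛ r₁.r y₁ = (u₁ /ₛ r₂.r y₁) * ((t : unitTorsor.{w}) /ₛ ofCircle.{w} 1) := by
      refine Eq.trans ?_ ((congrArg (fun x => x /ₛ o y₁) e₁).trans (ho y₁ u₁ t))
      exact (smul_sdiv _ _).symm
    have f₂ : p₂ /ₛ r₁.r y₂ = (u₂ /ₛ r₂.r y₂) * ((t : unitTorsor.{w}) /ₛ ofCircle.{w} 1) := by
      rw [← sdiv_ofCircle_cast r₁ r₂ L h t]
      refine Eq.trans ?_ ((congrArg (fun x => x /ₛ o y₂) e₂).trans (ho y₂ u₂ _))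
      exact (smul_sdiv _ _).symm
    have f₃ := r₁.iso_sdiv_q h p₁ p₂
    have f₄ := r₂.iso_sdiv_q h u₁ u₂
    have f₅ : (p₁ /ₛ r₁.r y₁) * (p₂ /ₛ r₁.r y₂)⁻¹ = (u₁ /ₛ r₂.r y₁) * (u₂ /ₛ r₂.r y₂)⁻¹ := by
      rw [f₁, f₂]
      refine Additive.ofMul.injective ?_
      simp only [ofMul_mul, ofMul_inv]
      abel
    rw [f₅, ← f₄, ← eq_smul_iff_sdiv_eq, sdiv_smul] at f₃
    exact f₃

end BundleGerbe

end Difference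

end BundleGerbes

end

/-! ### The theorem -/

theorem mainTheorem1
    {F K M : Type*} [NormedAddCommGroup F] [NormedSpace ℝ F] [FiniteDimensional ℝ F]
    [TopologicalSpace K] (J : ModelWithCorners ℝ F K) [J.Boundaryless]
    [TopologicalSpace M] [T2Space M] [SecondCountableTopology M]
    [ChartedSpace K M] [IsManifold J ∞ M]
    {E H Y : Type*} [NormedAddCommGroup E] [NormedSpace ℝ E]
    [TopologicalSpace H] (I : ModelWithCorners ℝ E H) [I.Boundaryless]
    [TopologicalSpace Y] [ChartedSpace H Y] [IsManifold I ∞ Y]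
    (π : Y → M) (hsurj : Function.Surjective π) (hsub : Manifold.IsSubmersion I J ∞ π)
    (G : BundleGerbes.BundleGerbe π I) :
    (∃! c : BundleGerbes.CechH M 3, G.IsDDClass J c) ∧ G.IsDDClass J (G.DD J) ∧
    (G.IsTrivial ↔ G.DD J = 0) ∧
    (G.DD J = 0 → ∀ T₁ T₂ : G.Trivialisation,
      ∃ Q : BundleGerbes.CircleBundle J (id : M → M), T₁.DifferBy T₂ hsub.contMDiff Q) := by
  -- With second countability and the Hausdorff property this makes `M` σ-compact and paracompact,
  -- as partitions of unity and locally finite refinements require.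
  have : LocallyCompactSpace M := Manifold.locallyCompact_of_finiteDimensional J
  obtain ⟨q⟩ := G.nonempty_mulSection hsurj
  obtain ⟨L⟩ := BundleGerbes.exists_localSections (J := J) hsurj hsub
  have h1 : ∃! c : BundleGerbes.CechH M 3, G.IsDDClass J c := by
    simp only [q.isDDClass_iff]
    exact BundleGerbes.GerbeCharts.existsUnique_isDDClass hsurj hsub
  have h2 : G.IsDDClass J (G.DD J) := Classical.epsilon_spec h1.exists
  have h3 : G.DD J = 0 ↔ q.charts.IsDDClass J 0 := by
    rw [← q.isDDClass_iff]
    exact ⟨fun h => h ▸ h2, fun h => h1.unique h2 h⟩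
  refine ⟨h1, h2, ?_, fun _ T₁ T₂ => ?_⟩
  · rw [BundleGerbes.BundleGerbe.isTrivial_iff q hsurj, h3]
    exact ⟨fun ⟨T⟩ => T.isDDClass_zero L,
      BundleGerbes.TrivialisationCharts.nonempty_of_isDDClass_zero hsub.contMDiff⟩
  · obtain ⟨r₁⟩ := BundleGerbes.BundleGerbe.nonempty_adaptedSection q hsurj T₁
    obtain ⟨r₂⟩ := BundleGerbes.BundleGerbe.nonempty_adaptedSection q hsurj T₂
    exact ⟨_, BundleGerbes.BundleGerbe.differBy_differenceBundle r₁ r₂ L hsub.contMDiff⟩
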